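/- Let $n\ge 2$ and let $\widehat{\mathbb C}^n=\{(z,\ell)\in\mathbb C^n\times\mathbb{CP}^{n-1}: z\in\ell\}$ be the blow-up of $\mathbb C^n$ at the origin, a complex manifold with exceptional divisor $\{z=0\}$. There exist functions $F:\mathbb R\to\mathbb R$ such that $F(t)-(t-1)\ln(t-1)$ is smooth on $[1,\infty)$ and $$F''(t)=\frac{(n-1)t+2-n}{t\,(t^n-(n-1)t-2+n)}\qquad(t>1).$$ Let $F$ be any such function. On $\Delta^\circ=\{x\in\mathbb R^n: x_i>0 \text{ for all } i,\ \sum_i x_i>1\}$ let $g(x)=\frac12\bigl[\sum_i x_i\ln x_i+F(t)\bigr]$ with $t=\sum_i x_i$, and let $G=(G_{ij})$ be the Hessian matrix of $g$, with inverse $(G^{ij})$. Points of the blow-up over $z\in(\mathbb C\setminus\{0\})^n$ have symplectic (action-angle) coordinates $(x,y)\in\Delta^\circ\times(\mathbb R/2\pi\mathbb Z)^n$ given by $z_i=\exp\bigl(\tfrac{\partial g}{\partial x_i}(x)+\sqrt{-1}\,y_i\bigr)$. Then there is a smooth Riemannian metric $h$ on $\widehat{\mathbb C}^n$ (a Burns–Simanca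 metric) with $$h=\sum_{i,j}G_{ij}\,dx_i\otimes dx_j+\sum_{i,j}G^{ij}\,dy_i\otimes dy_j$$ on this dense open set, and every such metric $h$ has the following two properties. 1. $h$ is asymptotically Euclidean with rate of decay $r^{2-2n}$: there is a biholomorphism of the complement of a compact subset of $\widehat{\mathbb C}^n$ onto the complement of a compact subset of $\mathbb C^n$ that carries $h$ to the Euclidean metric plus $O(r^{2-2n})$ as $r\to\infty$, where $r$ is the radius function on $\mathbb C^n$. 2. The flat coordinates $\lambda_i=\sqrt{2x_i}\cos y_i$, $\mu_i=\sqrt{2x_i}\sin y_i$ extend to a diffeomorphism of the complement of the exceptional divisor onto the region $u>1$ of $\mathbb R^{2n}$, where $u=\frac12\sum_i(\lambda_i^2+\mu_i^2)$ (the squared radius, up to the constant factor $\tfrac12$), and in these coordinates $$h=\sum_i\bigl(d\lambda_i\otimes d\lambda_i+d\mu_i\otimes d\mu_i\bigr)+O(u^{1-n})\qquad(u\to\infty).$$ In both parts the error is measured in the operator norm of the difference of the two bilinear forms with respect to the Euclidean norm. -/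

import Mathlib

open scoped ContDiff Manifold LinearAlgebra.Projectivization

/-- The complex vector space `ℂⁿ` with its standard Hermitian norm. -/
abbrev Cn (n : ℕ) : Type := EuclideanSpace ℂ (Fin n)

/-- Complex projective space carries the quotient topology of `ℂⁿ ∖ {0}`. -/
instance projTopology (n : ℕ) : TopologicalSpace (ℙ ℂ (Cn n)) :=
  inferInstanceAs (TopologicalSpace (Quotient (projectivizationSetoid ℂ (Cn n))))

/-- The blow-up of `ℂⁿ` at the origin: pairs `(z, ℓ)` of a point `z` of `ℂⁿ` and a line `ℓ`
through the origin that contains `z`. -/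
def BlowUp (n : ℕ) : Type := {p : Cn n × ℙ ℂ (Cn n) // p.1 ∈ p.2.submodule}

namespace BlowUp

variable {n : ℕ}

instance : TopologicalSpace (BlowUp n) :=
  inferInstanceAs (TopologicalSpace {p : Cn n × ℙ ℂ (Cn n) // p.1 ∈ p.2.submodule})

/-- The blow-down map. -/
def blowDown (p : BlowUp n) : Cn n := p.1.1

/-- The line component. -/
def line (p : BlowUp n) : ℙ ℂ (Cn n) := p.1.2

/-- The point of the blow-up over a nonzero point of `ℂⁿ`. -/
noncomputable def ofNeZero (z : Cn n) (hz : z ≠ 0) : BlowUp n :=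
  ⟨(z, Projectivization.mk ℂ z hz), by
    rw [Projectivization.submodule_mk]; exact Submodule.mem_span_singleton_self z⟩

/-- The ratio `ℓ_k / ℓ_j` of two homogeneous coordinates of a line. -/
noncomputable def ratio (j k : Fin n) (l : ℙ ℂ (Cn n)) : ℂ := l.rep k / l.rep j

/-- The vector with `j`-th entry `1` and the other entries those of `c`. -/
noncomputable def slope (j : Fin n) (c : Cn n) : Cn n :=
  WithLp.toLp 2 (Function.update c.ofLp j 1)

theorem slope_same (j : Fin n) (c : Cn n) : slope j c j = 1 := by simp [slope]

theorem slope_ne (j : Fin n) (c : Cn n) : slope j c ≠ 0 := fun h => by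
  have := slope_same j c
  rw [h] at this
  simp at this

theorem ratio_mk (j k : Fin n) (v : Cn n) (hv : v ≠ 0) :
    ratio j k (Projectivization.mk ℂ v hv) = v k / v j := by
  obtain ⟨a, ha⟩ := Projectivization.exists_smul_eq_mk_rep ℂ v hv
  have ha0 : (a : ℂ) ≠ 0 := a.ne_zero
  unfold ratio
  rw [← ha]
  simp only [Units.smul_def, PiLp.smul_apply, smul_eq_mul]
  exact mul_div_mul_left _ _ ha0

theorem rep_mk_ne_iff (j : Fin n) (v : Cn n) (hv : v ≠ 0) :
    (Projectivization.mk ℂ v hv).rep j ≠ 0 ↔ v j ≠ 0 := by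
  obtain ⟨a, ha⟩ := Projectivization.exists_smul_eq_mk_rep ℂ v hv
  rw [← ha]
  simp [Units.smul_def]

theorem isQuotientMap_mk :
    Topology.IsQuotientMap (fun v : {v : Cn n // v ≠ 0} => Projectivization.mk ℂ v.1 v.2) :=
  isQuotientMap_quotient_mk'

theorem isOpen_rep_ne (j : Fin n) : IsOpen {l : ℙ ℂ (Cn n) | l.rep j ≠ 0} := by
  rw [← isQuotientMap_mk.isOpen_preimage]
  have : ((fun v : {v : Cn n // v ≠ 0} => Projectivization.mk ℂ v.1 v.2) ⁻¹'
      {l : ℙ ℂ (Cn n) | l.rep j ≠ 0}) = {v | v.1 j ≠ 0} := by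
    ext v
    exact rep_mk_ne_iff j v.1 v.2
  rw [this]
  exact isOpen_ne_fun (by fun_prop) continuous_const

theorem continuousOn_ratio (j k : Fin n) :
    ContinuousOn (ratio j k) {l : ℙ ℂ (Cn n) | l.rep j ≠ 0} := by
  refine (isQuotientMap_mk.continuousOn_isOpen_iff (isOpen_rep_ne j)).2 ?_
  have : ((ratio j k) ∘ fun v : {v : Cn n // v ≠ 0} => Projectivization.mk ℂ v.1 v.2) =
      fun v => v.1 k / v.1 j := by
    ext v
    exact ratio_mk j k v.1 v.2
  rw [this]
  refine ContinuousOn.div (by fun_prop) (by fun_prop) ?_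
  intro v hv
  exact (rep_mk_ne_iff j v.1 v.2).1 hv

/-- The coordinates of the `j`-th affine chart: `z_j` in place `j`, and the ratio `ℓ_k / ℓ_j` in
every other place `k`. -/
noncomputable def chartFun (j : Fin n) (p : BlowUp n) : Cn n :=
  WithLp.toLp 2 (Function.update (fun k => ratio j k p.line) j (p.blowDown j))

/-- The inverse of `chartFun`. -/
noncomputable def chartInv (j : Fin n) (c : Cn n) : BlowUp n :=
  ⟨(c j • slope j c, Projectivization.mk ℂ (slope j c) (slope_ne j c)), by
    rw [Projectivization.submodule_mk]
    exact Submodule.smul_mem _ _ (Submodule.mem_span_singleton_self _)⟩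

theorem chartFun_chartInv (j : Fin n) (c : Cn n) : chartFun j (chartInv j c) = c := by
  ext k
  by_cases hk : k = j
  · subst hk
    simp [chartFun, chartInv, blowDown, slope_same]
  · simp [chartFun, chartInv, line, ratio_mk, slope, hk]

theorem chartInv_chartFun (j : Fin n) (p : BlowUp n) (hp : p.line.rep j ≠ 0) :
    chartInv j (chartFun j p) = p := by
  obtain ⟨⟨z, l⟩, hz⟩ := p
  have hp' : l.rep j ≠ 0 := hp
  have hs : slope j (chartFun j ⟨(z, l), hz⟩) = (l.rep j)⁻¹ • l.rep := by
    ext k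
    by_cases hk : k = j
    · subst hk
      simp [slope, hp']
    · simp [slope, chartFun, ratio, line, hk, div_eq_inv_mul]
  have hz' : z ∈ Submodule.span ℂ {l.rep} := by
    rw [← Projectivization.submodule_eq]; exact hz
  obtain ⟨a, rfl⟩ := Submodule.mem_span_singleton.1 hz'
  apply Subtype.ext
  refine Prod.ext ?_ ?_
  · change chartFun j _ j • slope j _ = a • l.rep
    rw [hs]
    have : chartFun j ⟨(a • l.rep, l), hz⟩ j = a * l.rep j := by
      simp [chartFun, blowDown]
    rw [this, smul_smul, mul_assoc, mul_inv_cancel₀ hp', mul_one]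
  · change Projectivization.mk ℂ (slope j _) _ = l
    conv_rhs => rw [← l.mk_rep]
    rw [Projectivization.mk_eq_mk_iff']
    exact ⟨_, hs.symm⟩

theorem continuous_blowDown : Continuous (blowDown : BlowUp n → Cn n) :=
  continuous_fst.comp continuous_subtype_val

theorem continuous_line : Continuous (line : BlowUp n → ℙ ℂ (Cn n)) :=
  continuous_snd.comp continuous_subtype_val

theorem continuous_slope (j : Fin n) : Continuous (slope j) := by
  unfold slope
  exact (PiLp.continuous_toLp 2 _).comp
    ((PiLp.continuous_ofLp 2 _).update j continuous_const)

theorem continuous_chartInv (j : Fin n) : Continuous (chartInv j) := by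
  refine Continuous.subtype_mk (Continuous.prodMk ?_ ?_) _
  · have := continuous_slope j
    fun_prop
  · exact isQuotientMap_mk.continuous.comp
      (Continuous.subtype_mk (continuous_slope j) (slope_ne j))

theorem continuousOn_chartFun (j : Fin n) :
    ContinuousOn (chartFun j) {p : BlowUp n | p.line.rep j ≠ 0} := by
  refine (PiLp.continuous_toLp 2 _).comp_continuousOn (continuousOn_pi.2 fun k => ?_)
  by_cases hk : k = j
  · subst hk
    simp only [Function.update_self]
    have := continuous_blowDown (n := n)
    exact Continuous.continuousOn (by fun_prop)
  · simp only [Function.update_of_ne hk]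
    exact (continuousOn_ratio j k).comp continuous_line.continuousOn fun p hp => hp

/-- The `j`-th affine chart of the blow-up, defined where the `j`-th homogeneous coordinate of
the line does not vanish. -/
noncomputable def affineChart (j : Fin n) : OpenPartialHomeomorph (BlowUp n) (Cn n) where
  toFun := chartFun j
  invFun := chartInv j
  source := {p | p.line.rep j ≠ 0}
  target := Set.univ
  map_source' _ _ := Set.mem_univ _
  map_target' c _ := (rep_mk_ne_iff j _ (slope_ne j c)).2 (by simp [slope_same])
  left_inv' p hp := chartInv_chartFun j p hp
  right_inv' c _ := chartFun_chartInv j c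
  open_source := (isOpen_rep_ne j).preimage continuous_line
  open_target := isOpen_univ
  continuousOn_toFun := continuousOn_chartFun j
  continuousOn_invFun := (continuous_chartInv j).continuousOn

theorem exists_rep_ne (p : BlowUp n) : ∃ j, p.line.rep j ≠ 0 := by
  by_contra! h
  exact p.line.rep_nonzero (by ext j; simpa using h j)

noncomputable instance : ChartedSpace (Cn n) (BlowUp n) where
  atlas := Set.range affineChart
  chartAt p := affineChart (exists_rep_ne p).choose
  mem_chart_source p := (exists_rep_ne p).choose_spec
  chart_mem_atlas _ := Set.mem_range_self _

theorem contDiffOn_transition (i j : Fin n) :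
    ContDiffOn ℂ ω (chartFun j ∘ chartInv i) {c | slope i c j ≠ 0} := by
  have hslope : ∀ k, ContDiff ℂ ω fun c : Cn n => slope i c k := by
    intro k
    by_cases hk : k = i
    · subst hk
      simp only [slope_same]
      exact contDiff_const
    · simp only [slope, Function.update_of_ne hk]
      fun_prop
  rw [contDiffOn_piLp]
  intro k
  by_cases hk : k = j
  · subst hk
    have : (fun c => (chartFun k ∘ chartInv i) c k) = fun c : Cn n => c i * slope i c k := by
      ext c
      simp [chartFun, chartInv, blowDown]
    rw [this]
    exact ((by fun_prop : ContDiff ℂ ω fun c : Cn n => c i).mul (hslope k)).contDiffOn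
  · have : (fun c => (chartFun j ∘ chartInv i) c k) =
        fun c : Cn n => slope i c k / slope i c j := by
      ext c
      simp [chartFun, chartInv, line, ratio_mk, hk]
    rw [this]
    exact (hslope k).contDiffOn.div (hslope j).contDiffOn fun c hc => hc

theorem transition_source (i j : Fin n) :
    ((affineChart i).symm.trans (affineChart j)).source = {c | slope i c j ≠ 0} := by
  ext c
  rw [OpenPartialHomeomorph.trans_source]
  have : c ∈ (affineChart i).symm.source := Set.mem_univ c
  rw [Set.mem_inter_iff, and_iff_right this]
  exact rep_mk_ne_iff j _ (slope_ne i c)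

/-- The blow-up is a complex manifold of dimension `n`. -/
instance isManifoldComplex : IsManifold 𝓘(ℂ, Cn n) ω (BlowUp n) := by
  apply isManifold_of_contDiffOn
  rintro _ _ ⟨i, rfl⟩ ⟨j, rfl⟩
  rw [transition_source]
  simp only [modelWithCornersSelf_coe, modelWithCornersSelf_coe_symm, Set.range_id,
    Set.preimage_id, Set.inter_univ, Function.comp_id, Function.id_comp]
  exact contDiffOn_transition i j

/-- The underlying smooth real manifold of the blow-up. -/
instance isManifoldReal : IsManifold 𝓘(ℝ, Cn n) ∞ (BlowUp n) := by
  apply isManifold_of_contDiffOn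
  rintro _ _ ⟨i, rfl⟩ ⟨j, rfl⟩
  rw [transition_source]
  simp only [modelWithCornersSelf_coe, modelWithCornersSelf_coe_symm, Set.range_id,
    Set.preimage_id, Set.inter_univ, Function.comp_id, Function.id_comp]
  exact ((contDiffOn_transition i j).restrict_scalars ℝ).of_le le_top

end BlowUp

/-- Smooth Riemannian metrics on the real manifold underlying a complex `n`-manifold. -/
abbrev SmoothMetric (n : ℕ) (M : Type) [TopologicalSpace M] [ChartedSpace (Cn n) M]
    [IsManifold 𝓘(ℝ, Cn n) ∞ M] : Type :=
  Bundle.ContMDiffRiemannianMetric 𝓘(ℝ, Cn n) ∞ (Cn n)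
    (fun p : M => TangentSpace 𝓘(ℝ, Cn n) p)

/-- The metric `h` in the coordinates `φ`: the bilinear form
`(v, w) ↦ h (d(φ⁻¹)_q v, d(φ⁻¹)_q w)` on `ℂⁿ = ℝ²ⁿ`, for `q` in the range of `φ`. -/
noncomputable def metricInCoordinates {n : ℕ} {M : Type} [TopologicalSpace M]
    [ChartedSpace (Cn n) M] [IsManifold 𝓘(ℝ, Cn n) ∞ M] (h : SmoothMetric n M)
    (φ : OpenPartialHomeomorph M (Cn n)) (q : Cn n) : Cn n →L[ℝ] Cn n →L[ℝ] ℝ :=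
  ContinuousLinearMap.bilinearComp (E := Cn n) (F := Cn n) (h.inner (φ.symm q))
    (mfderiv 𝓘(ℝ, Cn n) 𝓘(ℝ, Cn n) φ.symm q) (mfderiv 𝓘(ℝ, Cn n) 𝓘(ℝ, Cn n) φ.symm q)

/-- The Euclidean metric `∑ dλ_i² + dμ_i²` on `ℂⁿ`, where `λ_i + √-1 μ_i` are the standard
coordinates. -/
noncomputable def euclideanMetric (n : ℕ) : Cn n →L[ℝ] Cn n →L[ℝ] ℝ := innerSL ℝ

/-- `h` is asymptotically Euclidean with rate of decay `r ^ k`: there is a biholomorphism `φ` of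
the complement of a compact subset of `M` onto the complement of a compact subset of `ℂⁿ` in which
`h` is the Euclidean metric plus `O(r ^ k)` as `r → ∞`. -/
def IsAsymptoticallyEuclidean {n : ℕ} {M : Type} [TopologicalSpace M] [ChartedSpace (Cn n) M]
    [IsManifold 𝓘(ℝ, Cn n) ∞ M] (h : SmoothMetric n M) (k : ℤ) : Prop :=
  ∃ φ : OpenPartialHomeomorph M (Cn n),
    IsCompact φ.sourceᶜ ∧ IsCompact φ.targetᶜ ∧
    ContMDiffOn 𝓘(ℂ, Cn n) 𝓘(ℂ, Cn n) ω φ φ.source ∧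
    ContMDiffOn 𝓘(ℂ, Cn n) 𝓘(ℂ, Cn n) ω φ.symm φ.target ∧
    (fun q => metricInCoordinates h φ q - euclideanMetric n) =O[Bornology.cobounded (Cn n)]
      fun q => ‖q‖ ^ k

/-- The interior of the moment polytope of the blow-up. -/
def polytopeInterior (n : ℕ) : Set (Fin n → ℝ) :=
  {x | (∀ i, 0 < x i) ∧ 0 < ∑ i, x i - 1}

/-- `F` is a `t`-potential of the Burns–Simanca metric. -/
structure IsBurnsSimancaPotential (n : ℕ) (F : ℝ → ℝ) : Prop where
  smooth : ContDiffOn ℝ ∞ (fun t => F t - (t - 1) * Real.log (t - 1)) (Set.Ici 1)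
  deriv_two : ∀ t, 1 < t → deriv (deriv F) t =
    (((n : ℝ) - 1) * t + 2 - n) / (t * (t ^ n - ((n : ℝ) - 1) * t - 2 + n))

/-- The symplectic potential `g` with `t`-potential `F`. -/
noncomputable def symplecticPotential {n : ℕ} (F : ℝ → ℝ) (x : Fin n → ℝ) : ℝ :=
  (1 / 2) * (∑ i, x i * Real.log (x i) + F (∑ i, x i))

/-- The partial derivative `∂g/∂x_i`: the real part `a_i` of the logarithmic holomorphic coordinate
`a_i + √-1 y_i` at the symplectic coordinates `(x, y)`. -/
noncomputable def legendre {n : ℕ} (F : ℝ → ℝ) (i : Fin n) (x : Fin n → ℝ) : ℝ :=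
  fderiv ℝ (symplecticPotential F) x (Pi.single i 1)

/-- The Hessian matrix `G` of the symplectic potential. -/
noncomputable def potentialHessian {n : ℕ} (F : ℝ → ℝ) (x : Fin n → ℝ) :
    Matrix (Fin n) (Fin n) ℝ :=
  Matrix.of fun i j => fderiv ℝ (legendre F i) x (Pi.single j 1)

/-- The point of `ℂⁿ` with coordinates `z_i = exp (a_i + √-1 y_i)`, where `a = dg_x`. -/
noncomputable def toricVector {n : ℕ} (F : ℝ → ℝ) (xy : (Fin n → ℝ) × (Fin n → ℝ)) : Cn n :=
  WithLp.toLp 2 fun i => Complex.exp (legendre F i xy.1 + Complex.I * xy.2 i)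

theorem toricVector_ne_zero {n : ℕ} [NeZero n] (F : ℝ → ℝ)
    (xy : (Fin n → ℝ) × (Fin n → ℝ)) : toricVector F xy ≠ 0 := fun h => by
  have h0 := congrArg (fun z : Cn n => z 0) h
  exact Complex.exp_ne_zero _ h0

/-- The point of the blow-up with symplectic (action-angle) coordinates `(x, y)`. -/
noncomputable def toricPoint {n : ℕ} [NeZero n] (F : ℝ → ℝ)
    (xy : (Fin n → ℝ) × (Fin n → ℝ)) : BlowUp n :=
  BlowUp.ofNeZero (toricVector F xy) (toricVector_ne_zero F xy)

/-- The bilinear form `∑ G_ij dx_i ⊗ dx_j + ∑ G^ij dy_i ⊗ dy_j` at the point `x`. -/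
noncomputable def toricMetric {n : ℕ} (F : ℝ → ℝ) (x : Fin n → ℝ)
    (v w : (Fin n → ℝ) × (Fin n → ℝ)) : ℝ :=
  v.1 ⬝ᵥ (potentialHessian F x).mulVec w.1 + v.2 ⬝ᵥ (potentialHessian F x)⁻¹.mulVec w.2

/-- `h` is the metric on the blow-up determined by the symplectic potential with `t`-potential `F`:
on the dense open torus orbit, where `(x, y)` are coordinates, it is
`∑ G_ij dx_i ⊗ dx_j + ∑ G^ij dy_i ⊗ dy_j`. -/
def IsMetricOfPotential {n : ℕ} [NeZero n] (F : ℝ → ℝ) (h : SmoothMetric n (BlowUp n)) : Prop :=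
  ∀ x ∈ polytopeInterior n, ∀ y : Fin n → ℝ, ∀ v w : (Fin n → ℝ) × (Fin n → ℝ),
    h.inner (toricPoint F (x, y))
      (mfderiv 𝓘(ℝ, (Fin n → ℝ) × (Fin n → ℝ)) 𝓘(ℝ, Cn n) (toricPoint F) (x, y) v)
      (mfderiv 𝓘(ℝ, (Fin n → ℝ) × (Fin n → ℝ)) 𝓘(ℝ, Cn n) (toricPoint F) (x, y) w) =
    toricMetric F x v w

/-- The flat coordinates `λ_i + √-1 μ_i`, with `λ_i = √(2 x_i) cos y_i` and
`μ_i = √(2 x_i) sin y_i`, of the point with symplectic coordinates `(x, y)`. -/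
noncomputable def flatCoordinates {n : ℕ} (xy : (Fin n → ℝ) × (Fin n → ℝ)) : Cn n :=
  WithLp.toLp 2 fun i =>
    ⟨Real.sqrt (2 * xy.1 i) * Real.cos (xy.2 i), Real.sqrt (2 * xy.1 i) * Real.sin (xy.2 i)⟩

/-- In the flat coordinates `(λ, μ)`, extended smoothly from the torus orbit to the complement of
the exceptional divisor, whose image is the region `u > 1`, `u = ½ ∑ (λ_i² + μ_i²)`, the metric `h`
is the Euclidean metric plus `O(u ^ k)` as `u → ∞`. -/
def IsFlatUpTo {n : ℕ} [NeZero n] (F : ℝ → ℝ) (h : SmoothMetric n (BlowUp n)) (k : ℤ) : Prop :=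
  ∃ φ : OpenPartialHomeomorph (BlowUp n) (Cn n),
    φ.source = {p | p.blowDown ≠ 0} ∧ φ.target = {q | 1 < ‖q‖ ^ 2 / 2} ∧
    ContMDiffOn 𝓘(ℝ, Cn n) 𝓘(ℝ, Cn n) ∞ φ φ.source ∧
    ContMDiffOn 𝓘(ℝ, Cn n) 𝓘(ℝ, Cn n) ∞ φ.symm φ.target ∧
    (∀ x ∈ polytopeInterior n, ∀ y : Fin n → ℝ, φ (toricPoint F (x, y)) = flatCoordinates (x, y)) ∧
    (fun q => metricInCoordinates h φ q - euclideanMetric n) =O[Bornology.cobounded (Cn n)]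
      fun q => (‖q‖ ^ 2 / 2) ^ k

/-!
Write `s = |z|²` and let `t = ∑ x_i` be the moment. By the Legendre transform
`|z_i|² = x_i exp (1 + F' t)`, so `s = t exp (1 + F' t)` depends on `t` alone. Let `T` be the
inverse function, `t = T s`. A computation with the inverse Hessian (Sherman–Morrison) shows that
the toric metric of the symplectic potential is, in the coordinate `z ≠ 0`,
`(2 T / s) |dz|² + (2 T' / s - 2 T / s²) |⟨z, dz⟩|²` (`profileForm`, `profileForm_toricDeriv`).

*Existence.* Sending `(z, ℓ)` to `z` and the orthogonal projection `Π` onto `ℓ` maps the blow-up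
smoothly into a Euclidean space, and there the same metric reads `T |dΠ|² + 2 T' |Π dz|²`. This
expression makes sense on the exceptional divisor as well, where `T = t = 1`, and is positive
definite as soon as `T` is smooth with `T > 0` and `T' > 0` on `[0, ∞)`
(`BlowUp.ambientForm_pos`, `BlowUp.invariantMetric`). That `T` is smooth up to `s = 0` is the
condition on `F` at `t = 1`: the function `F'' - 1 / (t - 1)` extends smoothly across `t = 1`, so
that `exp (1 + F' t)` is `t - 1` times a positive smooth function, and `s` is a smooth function of
`t` with positive derivative and a simple zero at `t = 1`
(`IsBurnsSimancaPotential.exists_momentProfile`). Integrating the same smooth function twice gives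
a potential (`exists_potential`).

*Uniqueness off the divisor.* The torus orbit is dense and in symplectic coordinates the metric is
prescribed, so by continuity every metric of the potential is `profileForm T` for `z ≠ 0`
(`metricInCoordinates_eq_profileForm`).

*Asymptotics.* With `f = F''`, the equation for `F''` gives `t f = O(t ^ (1 - n))`, hence `F'`
increases to a limit `c` with `c - F' = O(t ^ (1 - n))`
(`IsBurnsSimancaPotential.exists_deriv_limit`). In the holomorphic coordinate
`z / ν`, where `ν² = exp (1 + c) / 2`, the metric is the Euclidean one up to terms of the order
of `exp (c - F') - 1` and `t f`, and `t` is comparable to `r²`. In the flat coordinates it is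
exactly the Euclidean metric plus `½ f dt² - 2 f / (1 + t f) (∑ x_i dy_i)²`
(`profileForm_ofFlat`), and both forms have norm at most a multiple of `t f`.
-/

open Bundle

/-! ### Pullbacks of bilinear forms -/

theorem contDiff_bilinearComp_self {E F : Type*} [NormedAddCommGroup F] [NormedSpace ℝ F]
    [FiniteDimensional ℝ F] [NormedAddCommGroup E] [NormedSpace ℝ E] :
    ContDiff ℝ ∞ (fun x : (E →L[ℝ] E →L[ℝ] ℝ) × (F →L[ℝ] E) => x.1.bilinearComp x.2 x.2) := by
  refine contDiff_clm_apply_iff.2 fun v => contDiff_clm_apply_iff.2 fun w => ?_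
  simp only [ContinuousLinearMap.bilinearComp_apply]
  exact (contDiff_fst.clm_apply (contDiff_snd.clm_apply contDiff_const)).clm_apply
    (contDiff_snd.clm_apply contDiff_const)

/-- The pullback of a smooth family `B` of bilinear forms on a vector space along a smooth map `Φ`
is a smooth section of the bundle of bilinear forms on the tangent spaces. -/
theorem contMDiff_pullback_bilinear {M E F : Type*} [NormedAddCommGroup F] [NormedSpace ℝ F]
    [FiniteDimensional ℝ F] [TopologicalSpace M] [ChartedSpace F M] [IsManifold 𝓘(ℝ, F) ∞ M]
    [NormedAddCommGroup E] [NormedSpace ℝ E] (Φ : M → E)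
    (hΦ : ContMDiff 𝓘(ℝ, F) 𝓘(ℝ, E) ∞ Φ) (B : M → E →L[ℝ] E →L[ℝ] ℝ)
    (hB : ContMDiff 𝓘(ℝ, F) 𝓘(ℝ, E →L[ℝ] E →L[ℝ] ℝ) ∞ B)
    (H : ∀ p : M, TangentSpace 𝓘(ℝ, F) p →L[ℝ] TangentSpace 𝓘(ℝ, F) p →L[ℝ] ℝ)
    (hH : ∀ p v w, H p v w =
      B p (mfderiv 𝓘(ℝ, F) 𝓘(ℝ, E) Φ p v) (mfderiv 𝓘(ℝ, F) 𝓘(ℝ, E) Φ p w)) :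
    ContMDiff 𝓘(ℝ, F) (𝓘(ℝ, F).prod 𝓘(ℝ, F →L[ℝ] F →L[ℝ] ℝ)) ∞
      (fun p => TotalSpace.mk' (F →L[ℝ] F →L[ℝ] ℝ)
        (E := fun p : M => TangentSpace 𝓘(ℝ, F) p →L[ℝ] TangentSpace 𝓘(ℝ, F) p →L[ℝ] ℝ) p
        (H p)) := by
  intro p₀
  have h1 := ContMDiffAt.mfderiv_const (m := ∞) (hΦ p₀) (by simp)
  rw [contMDiffAt_section]
  have h2 := (contDiff_bilinearComp_self (E := E) (F := F)).contMDiff.contMDiffAt.comp p₀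
    ((hB p₀).prodMk_space h1)
  refine h2.congr_of_eventuallyEq ?_
  filter_upwards [(trivializationAt F (TangentSpace 𝓘(ℝ, F)) p₀).open_baseSet.mem_nhds
      (FiberBundle.mem_baseSet_trivializationAt' p₀)] with p hp
  have e : ∀ v : F, inTangentCoordinates 𝓘(ℝ, F) 𝓘(ℝ, E) id Φ (mfderiv 𝓘(ℝ, F) 𝓘(ℝ, E) Φ) p₀ p v =
      mfderiv 𝓘(ℝ, F) 𝓘(ℝ, E) Φ p ((trivializationAt F (TangentSpace 𝓘(ℝ, F)) p₀).symm p v) := by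
    intro v
    change ContinuousLinearMap.inCoordinates F (TangentSpace 𝓘(ℝ, F)) E (TangentSpace 𝓘(ℝ, E))
      p₀ p (Φ p₀) (Φ p) (mfderiv 𝓘(ℝ, F) 𝓘(ℝ, E) Φ p) v = _
    rw [ContinuousLinearMap.inCoordinates_eq hp (Set.mem_univ _)]
    simp only [ContinuousLinearMap.comp_apply, ContinuousLinearEquiv.coe_coe]
    rw [Trivialization.coe_continuousLinearEquivAt_eq _ (Set.mem_univ _),
      Trivialization.symm_continuousLinearEquivAt_eq _ hp,
      TangentBundle.continuousLinearMapAt_model_space, Trivialization.symmL_apply _ hp]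
    rfl
  ext v w
  rw [hom_trivializationAt_apply]
  erw [inCoordinates_apply_eq₂ hp hp (Set.mem_univ _)]
  simp only [Function.comp_apply, ContinuousLinearMap.bilinearComp_apply, e]
  simp [hH]

/-- The Riemannian metric obtained by pulling back a smooth family `B` of symmetric bilinear forms on
a vector space along a smooth map `Φ`, when the result is positive definite. -/
noncomputable def pullbackMetric {n : ℕ} {M : Type} [TopologicalSpace M] [ChartedSpace (Cn n) M]
    [IsManifold 𝓘(ℝ, Cn n) ∞ M] {E : Type*} [NormedAddCommGroup E] [NormedSpace ℝ E]
    (Φ : M → E) (hΦ : ContMDiff 𝓘(ℝ, Cn n) 𝓘(ℝ, E) ∞ Φ) (B : M → E →L[ℝ] E →L[ℝ] ℝ)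
    (hB : ContMDiff 𝓘(ℝ, Cn n) 𝓘(ℝ, E →L[ℝ] E →L[ℝ] ℝ) ∞ B)
    (symm : ∀ p v w, B p v w = B p w v)
    (pos : ∀ (p : M) (v : TangentSpace 𝓘(ℝ, Cn n) p), v ≠ 0 →
      0 < B p (mfderiv 𝓘(ℝ, Cn n) 𝓘(ℝ, E) Φ p v) (mfderiv 𝓘(ℝ, Cn n) 𝓘(ℝ, E) Φ p v)) :
    SmoothMetric n M where
  inner p := ContinuousLinearMap.bilinearComp (E := E) (F := E) (E' := Cn n) (F' := Cn n) (B p)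
    (mfderiv 𝓘(ℝ, Cn n) 𝓘(ℝ, E) Φ p) (mfderiv 𝓘(ℝ, Cn n) 𝓘(ℝ, E) Φ p)
  symm p v w := symm p _ _
  pos p v hv := pos p v hv
  isVonNBounded p := by
    let T : Cn n →L[ℝ] E := mfderiv 𝓘(ℝ, Cn n) 𝓘(ℝ, E) Φ p
    have hc : Continuous fun v : Cn n => B p (T v) (T v) := by fun_prop
    have hpos : ∀ v : Cn n, v ≠ 0 → 0 < B p (T v) (T v) := fun v hv => pos p v hv
    -- the form is bounded below on the compact unit sphere, so its unit ball is bounded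
    obtain ⟨m, hm, hmin⟩ : ∃ m > 0, ∀ v ∈ Metric.sphere (0 : Cn n) 1, m ≤ B p (T v) (T v) := by
      rcases (Metric.sphere (0 : Cn n) 1).eq_empty_or_nonempty with he | hne
      · exact ⟨1, one_pos, by simp [he]⟩
      · obtain ⟨v₀, hv₀, hmin⟩ := (isCompact_sphere (0 : Cn n) 1).exists_isMinOn hne hc.continuousOn
        exact ⟨_, hpos v₀ (ne_zero_of_mem_unit_sphere ⟨v₀, hv₀⟩), fun v hv => hmin hv⟩
    have hb : Bornology.IsVonNBounded ℝ {v : Cn n | B p (T v) (T v) < 1} := by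
      refine (NormedSpace.isVonNBounded_ball ℝ (Cn n) (√(1 / m) + 1)).subset fun v hv => ?_
      have hv' : B p (T v) (T v) < 1 := hv
      rw [mem_ball_zero_iff]
      refine lt_of_le_of_lt (Real.le_sqrt_of_sq_le ?_) (lt_add_one _)
      rcases eq_or_ne v 0 with rfl | hv0
      · simp [hm.le]
      have hn : 0 < ‖v‖ := norm_pos_iff.2 hv0
      have h1 := hmin (‖v‖⁻¹ • v) (by simp [norm_smul, hn.ne'])
      simp only [map_smul, smul_apply, smul_eq_mul] at h1
      rw [le_div_iff₀ hm]
      have h2 : ‖v‖ ^ 2 * (‖v‖⁻¹ * (‖v‖⁻¹ * B p (T v) (T v))) = B p (T v) (T v) := by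
        field_simp
      have h3 := mul_le_mul_of_nonneg_left h1 (sq_nonneg ‖v‖)
      linarith
    exact hb
  contMDiff := contMDiff_pullback_bilinear Φ hΦ B hB _ fun _ _ _ => rfl

/-- The coefficients of a smooth metric in smooth coordinates are continuous. -/
theorem continuousOn_metricInCoordinates_apply {n : ℕ} {M : Type} [TopologicalSpace M]
    [ChartedSpace (Cn n) M] [IsManifold 𝓘(ℝ, Cn n) ∞ M] (h : SmoothMetric n M)
    (φ : OpenPartialHomeomorph M (Cn n))
    (hφ : ContMDiffOn 𝓘(ℝ, Cn n) 𝓘(ℝ, Cn n) ∞ φ.symm φ.target) (v w : Cn n) :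
    ContinuousOn (fun q => metricInCoordinates h φ q v w) φ.target := by
  -- `q ↦ d(φ⁻¹)_q v` is the tangent map of `φ⁻¹` along the constant vector field `v`
  have key : ∀ v : Cn n, ContMDiffOn 𝓘(ℝ, Cn n) (𝓘(ℝ, Cn n).prod 𝓘(ℝ, Cn n)) 0
      (fun q => TotalSpace.mk' (Cn n) (E := fun p : M => TangentSpace 𝓘(ℝ, Cn n) p) (φ.symm q)
        (mfderiv 𝓘(ℝ, Cn n) 𝓘(ℝ, Cn n) φ.symm q v)) φ.target := by
    intro v
    rw [contMDiffOn_zero_iff]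
    have h1 := hφ.continuousOn_tangentMapWithin (by simp) φ.open_target.uniqueMDiffOn
    have h2 : Continuous fun q : Cn n => (⟨q, v⟩ : TangentBundle 𝓘(ℝ, Cn n) (Cn n)) := by
      exact (tangentBundleModelSpaceHomeomorph 𝓘(ℝ, Cn n)).symm.continuous.comp
        (f := fun q : Cn n => (q, v)) (by fun_prop)
    have h3 := h1.comp h2.continuousOn (s := φ.target) (fun q hq => hq)
    refine h3.congr fun q hq => ?_
    simp only [Function.comp, tangentMapWithin, mfderivWithin_of_isOpen φ.open_target hq]
  have h4 : ContMDiffOn 𝓘(ℝ, Cn n) (𝓘(ℝ, Cn n).prod 𝓘(ℝ, ℝ)) 0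
      (fun q => TotalSpace.mk' ℝ (E := Bundle.Trivial M ℝ) (φ.symm q)
        (h.inner (φ.symm q) (mfderiv 𝓘(ℝ, Cn n) 𝓘(ℝ, Cn n) φ.symm q v)
          (mfderiv 𝓘(ℝ, Cn n) 𝓘(ℝ, Cn n) φ.symm q w))) φ.target := by
    apply ContMDiffOn.clm_bundle_apply₂ (F₁ := Cn n) (F₂ := Cn n)
    · exact (h.contMDiff.of_le (by simp)).comp_contMDiffOn (hφ.of_le (by simp))
    · exact key v
    · exact key w
  intro q hq
  have h5 := h4 q hq
  simp only [contMDiffWithinAt_totalSpace] at h5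
  exact h5.2.continuousWithinAt

/-! ### Smooth maps to and from the blow-up -/

namespace BlowUp

variable {n : ℕ}

section Charts

variable {𝕜 : Type*} [NontriviallyNormedField 𝕜] [NormedSpace 𝕜 (Cn n)] {m : ℕ∞ω}
  [IsManifold 𝓘(𝕜, Cn n) m (BlowUp n)] {E : Type*} [NormedAddCommGroup E] [NormedSpace 𝕜 E]

theorem affineChart_mem_maximalAtlas (j : Fin n) :
    affineChart j ∈ IsManifold.maximalAtlas 𝓘(𝕜, Cn n) m (BlowUp n) :=
  IsManifold.subset_maximalAtlas (Set.mem_range_self j)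

theorem contMDiff_chartInv (j : Fin n) :
    ContMDiff 𝓘(𝕜, Cn n) 𝓘(𝕜, Cn n) m (chartInv j) := by
  rw [← contMDiffOn_univ]
  exact contMDiffOn_symm_of_mem_maximalAtlas (affineChart_mem_maximalAtlas j)

/-- Smoothness of a function on the blow-up can be checked in an affine chart. -/
theorem contMDiffAt_of_comp_chartInv {f : BlowUp n → E} {p : BlowUp n} {j : Fin n}
    (hp : p.line.rep j ≠ 0) (hf : ContDiffAt 𝕜 m (f ∘ chartInv j) (chartFun j p)) :
    ContMDiffAt 𝓘(𝕜, Cn n) 𝓘(𝕜, E) m f p := by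
  have h1 : ContMDiffAt 𝓘(𝕜, Cn n) 𝓘(𝕜, Cn n) m (affineChart j) p :=
    contMDiffAt_of_mem_maximalAtlas (affineChart_mem_maximalAtlas j) hp
  have h2 : ContMDiffAt 𝓘(𝕜, Cn n) 𝓘(𝕜, E) m ((f ∘ chartInv j) ∘ affineChart j) p :=
    ContMDiffAt.comp p hf.contMDiffAt h1
  refine h2.congr_of_eventuallyEq ?_
  filter_upwards [(affineChart j).open_source.mem_nhds hp] with q hq
  exact congrArg f (chartInv_chartFun j q hq).symm

/-- Smoothness of a map into the blow-up can be checked in an affine chart. -/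
theorem contMDiffAt_of_chartFun_comp {f : E → BlowUp n} {x : E} {j : Fin n}
    (hx : ∀ᶠ y in nhds x, (f y).line.rep j ≠ 0)
    (hf : ContDiffAt 𝕜 m (chartFun j ∘ f) x) :
    ContMDiffAt 𝓘(𝕜, E) 𝓘(𝕜, Cn n) m f x := by
  have h2 : ContMDiffAt 𝓘(𝕜, E) 𝓘(𝕜, Cn n) m (chartInv j ∘ (chartFun j ∘ f)) x :=
    ContMDiffAt.comp x (contMDiff_chartInv j _) hf.contMDiffAt
  refine h2.congr_of_eventuallyEq ?_
  filter_upwards [hx] with y hy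
  exact (chartInv_chartFun j _ hy).symm

end Charts

theorem contDiff_slope (i : Fin n) : ContDiff ℂ ω (slope i) := by
  rw [contDiff_piLp]
  intro k
  by_cases hk : k = i
  · subst hk
    simp only [slope_same]
    exact contDiff_const
  · simp only [slope, Function.update_of_ne hk]
    fun_prop

theorem blowDown_comp_chartInv (j : Fin n) :
    (blowDown ∘ chartInv j) = fun c : Cn n => c j • slope j c := rfl

theorem contDiff_blowDown_comp_chartInv (j : Fin n) :
    ContDiff ℂ ω (blowDown ∘ chartInv j : Cn n → Cn n) := by
  rw [blowDown_comp_chartInv]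
  have h : ContDiff ℂ ω fun c : Cn n => c j := by fun_prop
  exact h.smul (contDiff_slope j)

theorem contMDiff_blowDown_complex : ContMDiff 𝓘(ℂ, Cn n) 𝓘(ℂ, Cn n) ω (blowDown (n := n)) := by
  intro p
  obtain ⟨j, hj⟩ := exists_rep_ne p
  exact contMDiffAt_of_comp_chartInv hj (contDiff_blowDown_comp_chartInv j).contDiffAt

theorem contMDiff_blowDown_real : ContMDiff 𝓘(ℝ, Cn n) 𝓘(ℝ, Cn n) ∞ (blowDown (n := n)) := by
  intro p
  obtain ⟨j, hj⟩ := exists_rep_ne p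
  exact contMDiffAt_of_comp_chartInv hj
    (((contDiff_blowDown_comp_chartInv j).restrict_scalars ℝ).of_le le_top).contDiffAt

theorem ofNeZero_blowDown (p : BlowUp n) (hp : p.blowDown ≠ 0) :
    ofNeZero p.blowDown hp = p := by
  obtain ⟨⟨z, l⟩, hz⟩ := p
  have hp' : z ≠ 0 := hp
  refine Subtype.ext (Prod.ext rfl ?_)
  change Projectivization.mk ℂ z hp' = l
  have hz' : z ∈ Submodule.span ℂ {l.rep} := by
    rw [← Projectivization.submodule_eq]; exact hz
  obtain ⟨a, ha⟩ := Submodule.mem_span_singleton.1 hz'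
  conv_rhs => rw [← l.mk_rep]
  rw [Projectivization.mk_eq_mk_iff']
  exact ⟨a, ha⟩

open Classical in
/-- The inverse of the blow-down map off the origin; the value at the origin is irrelevant. -/
noncomputable def blowUpPoint [NeZero n] (z : Cn n) : BlowUp n :=
  if hz : z ≠ 0 then ofNeZero z hz else chartInv 0 0

theorem blowUpPoint_of_ne [NeZero n] {z : Cn n} (hz : z ≠ 0) :
    blowUpPoint z = ofNeZero z hz := dif_pos hz

theorem exists_coord_ne {z : Cn n} (hz : z ≠ 0) : ∃ j, z j ≠ 0 := by
  by_contra! h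
  exact hz (by ext j; simpa using h j)

theorem chartFun_blowUpPoint [NeZero n] (j : Fin n) {z : Cn n} (hz : z ≠ 0) :
    chartFun j (blowUpPoint z) =
      WithLp.toLp 2 (Function.update (fun k => z k / z j) j (z j)) := by
  rw [blowUpPoint_of_ne hz]
  simp [chartFun, ofNeZero, line, blowDown, ratio_mk]

theorem eventually_rep_blowUpPoint_ne [NeZero n] {z : Cn n} {j : Fin n} (hj : z j ≠ 0) :
    ∀ᶠ y in nhds z, (blowUpPoint y).line.rep j ≠ 0 := by
  have hc : ContinuousAt (fun y : Cn n => y j) z := by fun_prop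
  filter_upwards [hc.eventually_ne hj] with y hy
  have hy0 : y ≠ 0 := fun h => hy (by simp [h])
  rw [blowUpPoint_of_ne hy0]
  exact (rep_mk_ne_iff j y hy0).2 hy

theorem contDiffAt_chartFun_blowUpPoint [NeZero n] {z : Cn n} {j : Fin n} (hj : z j ≠ 0) :
    ContDiffAt ℂ ω (chartFun j ∘ blowUpPoint) z := by
  have h1 : ContDiffAt ℂ ω
      (fun z : Cn n => WithLp.toLp 2 (Function.update (fun k => z k / z j) j (z j))) z := by
    rw [contDiffAt_piLp]
    intro k
    by_cases hk : k = j
    · subst hk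
      simp only [Function.update_self]
      fun_prop
    · simp only [Function.update_of_ne hk]
      exact ContDiffAt.div (by fun_prop) (by fun_prop) hj
  have hc : ContinuousAt (fun y : Cn n => y j) z := by fun_prop
  refine h1.congr_of_eventuallyEq ?_
  filter_upwards [hc.eventually_ne hj] with y hy
  exact chartFun_blowUpPoint j fun h => hy (by simp [h])

theorem contMDiffAt_blowUpPoint_complex [NeZero n] {z : Cn n} (hz : z ≠ 0) :
    ContMDiffAt 𝓘(ℂ, Cn n) 𝓘(ℂ, Cn n) ω blowUpPoint z := by
  obtain ⟨j, hj⟩ := exists_coord_ne hz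
  exact contMDiffAt_of_chartFun_comp (eventually_rep_blowUpPoint_ne hj)
    (contDiffAt_chartFun_blowUpPoint hj)

theorem contMDiffAt_blowUpPoint_real [NeZero n] {z : Cn n} (hz : z ≠ 0) :
    ContMDiffAt 𝓘(ℝ, Cn n) 𝓘(ℝ, Cn n) ∞ blowUpPoint z := by
  obtain ⟨j, hj⟩ := exists_coord_ne hz
  exact contMDiffAt_of_chartFun_comp (eventually_rep_blowUpPoint_ne hj)
    (((contDiffAt_chartFun_blowUpPoint hj).restrict_scalars ℝ).of_le le_top)

/-- The blow-down map as a homeomorphism of the complement of the exceptional divisor onto the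
complement of the origin. -/
noncomputable def blowDownHomeo (n : ℕ) [NeZero n] :
    OpenPartialHomeomorph (BlowUp n) (Cn n) where
  toFun := blowDown
  invFun := blowUpPoint
  source := {p | p.blowDown ≠ 0}
  target := {z | z ≠ 0}
  map_source' _ hp := hp
  map_target' z hz := by
    change (blowUpPoint z).blowDown ≠ 0
    rw [blowUpPoint_of_ne hz]; exact hz
  left_inv' p hp := by rw [blowUpPoint_of_ne hp, ofNeZero_blowDown]
  right_inv' z hz := by rw [blowUpPoint_of_ne hz]; rfl
  open_source := isOpen_ne_fun continuous_blowDown continuous_const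
  open_target := isOpen_ne
  continuousOn_toFun := continuous_blowDown.continuousOn
  continuousOn_invFun z hz :=
    (contMDiffAt_blowUpPoint_real hz).continuousAt.continuousWithinAt

end BlowUp

/-! ### The orthogonal projection onto a line -/

/-- The matrix `u v*`, as a point of the Euclidean space of `n × n` matrices with the
Hilbert–Schmidt inner product. -/
noncomputable def outer {n : ℕ} (u v : Cn n) : EuclideanSpace ℂ (Fin n × Fin n) :=
  WithLp.toLp 2 fun k => u k.1 * (starRingEnd ℂ) (v k.2)

section outer

variable {n : ℕ}

theorem outer_apply (u v : Cn n) (k : Fin n × Fin n) :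
    outer u v k = u k.1 * (starRingEnd ℂ) (v k.2) := rfl

theorem real_inner_eq_re {ι : Type*} [Fintype ι] (v w : EuclideanSpace ℂ ι) :
    inner ℝ v w = (inner ℂ v w).re := by
  simp [PiLp.inner_apply, Complex.inner]

theorem real_inner_outer (u v u' v' : Cn n) :
    inner ℝ (outer u v) (outer u' v') = (inner ℂ u u' * inner ℂ v' v).re := by
  rw [real_inner_eq_re]
  congr 1
  simp only [PiLp.inner_apply, outer_apply, Fintype.sum_prod_type, Finset.sum_mul_sum,
    RCLike.inner_apply, map_mul, Complex.conj_conj]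
  refine Finset.sum_congr rfl fun i _ => Finset.sum_congr rfl fun j _ => ?_
  ring

theorem outer_add_left (u u' v : Cn n) : outer (u + u') v = outer u v + outer u' v := by
  ext k; simp [outer_apply, add_mul]

theorem outer_add_right (u v v' : Cn n) : outer u (v + v') = outer u v + outer u v' := by
  ext k; simp [outer_apply, mul_add]

theorem outer_smul_left (a : ℝ) (u v : Cn n) : outer (a • u) v = a • outer u v := by
  ext k; simp [outer_apply, mul_assoc]

theorem outer_smul_right (a : ℝ) (u v : Cn n) : outer u (a • v) = a • outer u v := by
  ext k; simp [outer_apply, mul_left_comm]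

theorem outer_smul_smul (a : ℂ) (u v : Cn n) :
    outer (a • u) (a • v) = (‖a‖ ^ 2) • outer u v := by
  ext k
  have : ((‖a‖ ^ 2 : ℝ) : ℂ) = a * (starRingEnd ℂ) a := by
    rw [Complex.mul_conj, Complex.normSq_eq_norm_sq]
  simp only [outer_apply, PiLp.smul_apply, smul_eq_mul, map_mul, Complex.real_smul, this]
  ring

/-- The matrix `v v* / |v|²` of the orthogonal projection onto the line spanned by `v ≠ 0`. -/
noncomputable def lineProj (v : Cn n) : EuclideanSpace ℂ (Fin n × Fin n) :=
  (‖v‖ ^ 2)⁻¹ • outer v v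

theorem lineProj_smul {a : ℂ} (ha : a ≠ 0) (v : Cn n) : lineProj (a • v) = lineProj v := by
  rw [lineProj, lineProj, outer_smul_smul, smul_smul, norm_smul, mul_pow, mul_inv]
  congr 1
  have : ‖a‖ ≠ 0 := norm_ne_zero_iff.2 ha
  field_simp

theorem contDiff_outer_self : ContDiff ℝ ∞ fun v : Cn n => outer v v := by
  rw [contDiff_piLp]
  intro k
  have h : ∀ i : Fin n, ContDiff ℝ ∞ fun v : Cn n => v i := fun i => by
    have : ContDiff ℂ ∞ fun v : Cn n => v i := by fun_prop
    exact this.restrict_scalars ℝ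
  exact (h k.1).mul (Complex.conjCLE.contDiff.comp (h k.2))

theorem contDiffAt_inv_norm_sq_smul {V : Type*} [NormedAddCommGroup V] [NormedSpace ℝ V]
    {f : Cn n → V} {v : Cn n} (hf : ContDiffAt ℝ ∞ f v) (hv : v ≠ 0) :
    ContDiffAt ℝ ∞ (fun z => (‖z‖ ^ 2)⁻¹ • f z) v :=
  ContDiffAt.smul ((contDiff_norm_sq ℝ).contDiffAt.inv (pow_ne_zero 2 (norm_ne_zero_iff.2 hv))) hf

theorem contDiffAt_lineProj {v : Cn n} (hv : v ≠ 0) : ContDiffAt ℝ ∞ lineProj v :=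
  contDiffAt_inv_norm_sq_smul contDiff_outer_self.contDiffAt hv

theorem fderiv_lineProj {z : Cn n} (hz : z ≠ 0) (v : Cn n) :
    fderiv ℝ lineProj z v = (‖z‖ ^ 2)⁻¹ • (outer v z + outer z v) -
      (2 * inner ℝ z v / (‖z‖ ^ 2) ^ 2) • outer z z := by
  -- both sides are the derivative at `t = 0` along the line `z + t v`, on which the numerator of the
  -- projection is a quadratic polynomial in `t`
  have hd := (contDiffAt_lineProj hz).differentiableAt (by simp)
  have h1 : HasDerivAt (fun t : ℝ => lineProj (z + t • v)) (fderiv ℝ lineProj z v) 0 := by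
    have h : HasFDerivAt lineProj (fderiv ℝ lineProj z) (z + (0 : ℝ) • v) := by
      simpa using hd.hasFDerivAt
    have h2 : HasDerivAt (fun t : ℝ => z + t • v) v 0 := by
      simpa using ((hasDerivAt_id (0 : ℝ)).smul_const v).const_add z
    exact h.comp_hasDerivAt (0 : ℝ) h2
  have hn : ‖z‖ ^ 2 ≠ 0 := pow_ne_zero 2 (norm_ne_zero_iff.2 hz)
  have h3 : HasDerivAt (fun t : ℝ => ‖z + t • v‖ ^ 2) (2 * inner ℝ z v) 0 := by
    have h2 : HasDerivAt (fun t : ℝ => z + t • v) v 0 := by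
      simpa using ((hasDerivAt_id (0 : ℝ)).smul_const v).const_add z
    simpa using h2.norm_sq
  have h4 : HasDerivAt (fun t : ℝ => outer (z + t • v) (z + t • v)) (outer v z + outer z v) 0 := by
    have : (fun t : ℝ => outer (z + t • v) (z + t • v)) =
        fun t : ℝ => outer z z + t • (outer v z + outer z v) + (t ^ 2) • outer v v := by
      ext1 t
      simp only [outer_add_left, outer_add_right, outer_smul_left, outer_smul_right]
      module
    rw [this]
    have h5 := (((hasDerivAt_id (0 : ℝ)).smul_const (outer v z + outer z v)).const_add
      (outer z z)).add ((hasDerivAt_pow 2 (0 : ℝ)).smul_const (outer v v))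
    exact h5.congr_deriv (by simp)
  have h6 := (h3.inv (by simpa using hn)).smul h4
  have h7 := h1.unique h6
  rw [h7]
  simp only [zero_smul, add_zero, Pi.inv_apply]
  module

/-- The pullback `|dΠ|²` to `ℂⁿ ∖ {0}` is twice the Fubini–Study metric. -/
theorem real_inner_fderiv_lineProj {z : Cn n} (hz : z ≠ 0) (v w : Cn n) :
    inner ℝ (fderiv ℝ lineProj z v) (fderiv ℝ lineProj z w) =
      2 * inner ℝ v w / ‖z‖ ^ 2 -
        2 * inner ℝ (inner ℂ z v) (inner ℂ z w) / (‖z‖ ^ 2) ^ 2 := by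
  have hn : ‖z‖ ^ 2 ≠ 0 := pow_ne_zero 2 (norm_ne_zero_iff.2 hz)
  rw [fderiv_lineProj hz, fderiv_lineProj hz]
  simp only [inner_sub_left, inner_sub_right, inner_add_left, inner_add_right,
    real_inner_smul_left, real_inner_smul_right, real_inner_outer]
  have hzz : inner ℂ z z = ((‖z‖ ^ 2 : ℝ) : ℂ) := by
    rw [inner_self_eq_norm_sq_to_K]; simp
  rw [hzz, ← inner_conj_symm v z, ← inner_conj_symm w z, ← inner_conj_symm w v,
    real_inner_eq_re z v, real_inner_eq_re z w, real_inner_eq_re v w]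
  generalize ‖z‖ ^ 2 = s at *
  generalize inner ℂ z v = a
  generalize inner ℂ z w = b
  generalize inner ℂ v w = c
  simp only [Complex.inner, Complex.mul_re, Complex.conj_re, Complex.conj_im, Complex.ofReal_re,
    Complex.ofReal_im]
  field_simp
  ring

/-- The form `(v, w) ↦ Re (conj ⟨z, v⟩ ⟨z, w⟩)`, that is, `|⟨z, dz⟩|²`. -/
noncomputable def radialForm (z : Cn n) : Cn n →L[ℝ] Cn n →L[ℝ] ℝ :=
  ContinuousLinearMap.bilinearComp (innerSL ℝ : ℂ →L[ℝ] ℂ →L[ℝ] ℝ)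
    ((innerSL ℂ z).restrictScalars ℝ) ((innerSL ℂ z).restrictScalars ℝ)

theorem radialForm_apply (z v w : Cn n) :
    radialForm z v w = inner ℝ (inner ℂ z v) (inner ℂ z w) := rfl

theorem norm_radialForm_le (z : Cn n) : ‖radialForm z‖ ≤ ‖z‖ ^ 2 := by
  refine ContinuousLinearMap.opNorm_le_bound₂ _ (by positivity) fun v w => ?_
  rw [radialForm_apply]
  calc _ ≤ ‖(inner ℂ z v : ℂ)‖ * ‖(inner ℂ z w : ℂ)‖ := norm_inner_le_norm _ _
    _ ≤ (‖z‖ * ‖v‖) * (‖z‖ * ‖w‖) := by gcongr <;> exact norm_inner_le_norm _ _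
    _ = _ := by ring

theorem radialForm_smul (a : ℂ) (z : Cn n) : radialForm (a • z) = ‖a‖ ^ 2 • radialForm z := by
  ext v w
  simp only [radialForm_apply, inner_smul_left, smul_apply, smul_eq_mul]
  rw [Complex.inner, Complex.inner, ← Complex.normSq_eq_norm_sq, Complex.normSq_apply]
  simp
  ring

theorem contDiff_radialForm : ContDiff ℝ ∞ fun z : Cn n => radialForm z := by
  refine contDiff_clm_apply_iff.2 fun v => contDiff_clm_apply_iff.2 fun w => ?_
  simp only [radialForm_apply]
  exact (contDiff_id.inner ℂ contDiff_const).inner ℝ (contDiff_id.inner ℂ contDiff_const)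

/-- The form `(v, w) ↦ Re ⟨π v, π w⟩`, where `π` is the orthogonal projection onto the line
spanned by `z`. -/
noncomputable def lineForm (z : Cn n) : Cn n →L[ℝ] Cn n →L[ℝ] ℝ :=
  (‖z‖ ^ 2)⁻¹ • radialForm z

theorem lineForm_smul {a : ℂ} (ha : a ≠ 0) (z : Cn n) : lineForm (a • z) = lineForm z := by
  rw [lineForm, lineForm, radialForm_smul, smul_smul, norm_smul, mul_pow, mul_inv]
  congr 1
  have : ‖a‖ ≠ 0 := norm_ne_zero_iff.2 ha
  field_simp

theorem contDiffAt_lineForm {z : Cn n} (hz : z ≠ 0) : ContDiffAt ℝ ∞ (fun z => lineForm z) z :=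
  contDiffAt_inv_norm_sq_smul contDiff_radialForm.contDiffAt hz

end outer

/-! ### Invariant metrics on the blow-up -/

namespace BlowUp

variable {n : ℕ}

theorem lineProj_rep_mk (v : Cn n) (hv : v ≠ 0) :
    lineProj (Projectivization.mk ℂ v hv).rep = lineProj v := by
  obtain ⟨a, ha⟩ := Projectivization.exists_smul_eq_mk_rep ℂ v hv
  rw [← ha, Units.smul_def, lineProj_smul a.ne_zero]

theorem lineForm_rep_mk (v : Cn n) (hv : v ≠ 0) :
    lineForm (Projectivization.mk ℂ v hv).rep = lineForm v := by
  obtain ⟨a, ha⟩ := Projectivization.exists_smul_eq_mk_rep ℂ v hv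
  rw [← ha, Units.smul_def, lineForm_smul a.ne_zero]

/-- The embedding of the blow-up into a Euclidean space that sends `(z, ℓ)` to `z` and the
orthogonal projection onto `ℓ`. -/
noncomputable def embed (p : BlowUp n) : Cn n × EuclideanSpace ℂ (Fin n × Fin n) :=
  (p.blowDown, lineProj p.line.rep)

theorem embed_chartInv (j : Fin n) (c : Cn n) :
    embed (chartInv j c) = (c j • slope j c, lineProj (slope j c)) :=
  Prod.ext rfl (lineProj_rep_mk _ (slope_ne j c))

theorem contDiff_slope_real (j : Fin n) : ContDiff ℝ ∞ (slope j) :=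
  ((contDiff_slope j).restrict_scalars ℝ).of_le le_top

theorem contDiff_coord_smul_slope (j : Fin n) :
    ContDiff ℝ ∞ fun c : Cn n => c j • slope j c :=
  ((contDiff_blowDown_comp_chartInv j).restrict_scalars ℝ).of_le le_top

theorem contDiff_embed_chartInv (j : Fin n) :
    ContDiff ℝ ∞ (embed ∘ chartInv j : Cn n → _) := by
  have : (embed ∘ chartInv j : Cn n → _) =
      fun c => (c j • slope j c, lineProj (slope j c)) := funext (embed_chartInv j)
  rw [this]
  exact (contDiff_coord_smul_slope j).prodMk (contDiff_iff_contDiffAt.2 fun c =>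
    (contDiffAt_lineProj (slope_ne j c)).comp c (contDiff_slope_real j).contDiffAt)

theorem contMDiff_embed : ContMDiff 𝓘(ℝ, Cn n)
    𝓘(ℝ, Cn n × EuclideanSpace ℂ (Fin n × Fin n)) ∞ (embed (n := n)) := by
  intro p
  obtain ⟨j, hj⟩ := exists_rep_ne p
  exact contMDiffAt_of_comp_chartInv hj (contDiff_embed_chartInv j).contDiffAt

/-- The bilinear form `T(|z|²) ⟨dΠ, dΠ⟩ + 2 T'(|z|²) ⟨Π dz, Π dz⟩` on the ambient space of
`embed`, at the point `(z, ℓ)`, where `Π` is the orthogonal projection onto `ℓ`. -/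
noncomputable def ambientForm (T : ℝ → ℝ) (p : BlowUp n) :
    (Cn n × EuclideanSpace ℂ (Fin n × Fin n)) →L[ℝ]
      (Cn n × EuclideanSpace ℂ (Fin n × Fin n)) →L[ℝ] ℝ :=
  T (‖p.blowDown‖ ^ 2) • (innerSL ℝ).bilinearComp
      (ContinuousLinearMap.snd ℝ _ _) (ContinuousLinearMap.snd ℝ _ _) +
    (2 * deriv T (‖p.blowDown‖ ^ 2)) • (lineForm p.line.rep).bilinearComp
      (ContinuousLinearMap.fst ℝ _ _) (ContinuousLinearMap.fst ℝ _ _)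

theorem ambientForm_apply (T : ℝ → ℝ) (p : BlowUp n)
    (X Y : Cn n × EuclideanSpace ℂ (Fin n × Fin n)) :
    ambientForm T p X Y = T (‖p.blowDown‖ ^ 2) * inner ℝ X.2 Y.2 +
      2 * deriv T (‖p.blowDown‖ ^ 2) * lineForm p.line.rep X.1 Y.1 := rfl

/-- The conditions on the function `T` of `s = |z|²` that make it the moment `t` of a smooth
`U(n)`-invariant Kähler metric on the blow-up. -/
structure _root_.IsMomentProfile (T : ℝ → ℝ) : Prop where
  smooth : ∀ s, 0 ≤ s → ContDiffAt ℝ ∞ T s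
  pos : ∀ s, 0 ≤ s → 0 < T s
  deriv_pos : ∀ s, 0 ≤ s → 0 < deriv T s

theorem contMDiff_ambientForm {T : ℝ → ℝ} (hT : IsMomentProfile T) :
    ContMDiff 𝓘(ℝ, Cn n) 𝓘(ℝ, (Cn n × EuclideanSpace ℂ (Fin n × Fin n)) →L[ℝ]
      (Cn n × EuclideanSpace ℂ (Fin n × Fin n)) →L[ℝ] ℝ) ∞ (ambientForm (n := n) T) := by
  intro p
  obtain ⟨j, hj⟩ := exists_rep_ne p
  refine contMDiffAt_of_comp_chartInv hj (contDiff_iff_contDiffAt.1 ?_ _)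
  refine contDiff_clm_apply_iff.2 fun X => contDiff_clm_apply_iff.2 fun Y => ?_
  have h0 : ∀ c, (ambientForm T ∘ chartInv j) c X Y =
      T (‖c j • slope j c‖ ^ 2) * inner ℝ X.2 Y.2 +
      2 * deriv T (‖c j • slope j c‖ ^ 2) * lineForm (slope j c) X.1 Y.1 := by
    intro c
    rw [← lineForm_rep_mk _ (slope_ne j c)]
    rfl
  simp only [h0]
  rw [contDiff_iff_contDiffAt]
  intro c
  have h1 : ContDiffAt ℝ ∞ (fun c : Cn n => ‖c j • slope j c‖ ^ 2) c :=
    ((contDiff_norm_sq ℝ).comp (contDiff_coord_smul_slope j)).contDiffAt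
  have h2 := hT.smooth (‖c j • slope j c‖ ^ 2) (by positivity)
  have h3 : ContDiffAt ℝ ∞ (deriv T) (‖c j • slope j c‖ ^ 2) := by
    have := h2.fderiv_right (m := ∞) (by simp)
    exact this.clm_apply contDiffAt_const
  have h4 := (contDiffAt_lineForm (slope_ne j c)).comp c (contDiff_slope_real j).contDiffAt
  have h5 := (h4.clm_apply (contDiffAt_const (c := X.1))).clm_apply (contDiffAt_const (c := Y.1))
  exact ((h2.comp c h1).mul contDiffAt_const).add ((contDiffAt_const.mul (h3.comp c h1)).mul h5)

theorem ambientForm_symm (T : ℝ → ℝ) (p : BlowUp n)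
    (X Y : Cn n × EuclideanSpace ℂ (Fin n × Fin n)) :
    ambientForm T p X Y = ambientForm T p Y X := by
  simp only [ambientForm_apply, lineForm, smul_apply, radialForm_apply]
  rw [real_inner_comm, real_inner_comm (inner ℂ _ X.1)]

/-- A tangent vector `u` vanishes if neither the line moves along `u` (`h1`) nor the point moves
inside its line (`h2`). -/
theorem eq_zero_of_fderiv_slope (j : Fin n) (c u : Cn n)
    (h1 : fderiv ℝ (fun c => lineProj (slope j c)) c u = 0)
    (h2 : lineForm (slope j c) (fderiv ℝ (fun c : Cn n => c j • slope j c) c u)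
      (fderiv ℝ (fun c : Cn n => c j • slope j c) c u) = 0) : u = 0 := by
  have hcurve : HasDerivAt (fun t : ℝ => c + t • u) u 0 := by
    simpa using ((hasDerivAt_id (0 : ℝ)).smul_const u).const_add c
  have hchain : ∀ {V : Type} [NormedAddCommGroup V] [NormedSpace ℝ V] (f : Cn n → V),
      DifferentiableAt ℝ f c → HasDerivAt (fun t : ℝ => f (c + t • u)) (fderiv ℝ f c u) 0 := by
    intro V _ _ f hf
    have h : HasFDerivAt f (fderiv ℝ f c) (c + (0 : ℝ) • u) := by simpa using hf.hasFDerivAt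
    exact h.comp_hasDerivAt (0 : ℝ) hcurve
  have hσ : ‖slope j c‖ ^ 2 ≠ 0 := pow_ne_zero 2 (norm_ne_zero_iff.2 (slope_ne j c))
  have hd1 := hchain (fun c => lineProj (slope j c))
    (((contDiffAt_lineProj (slope_ne j c)).comp c
      (contDiff_slope_real j).contDiffAt).differentiableAt (by simp))
  rw [h1] at hd1
  have hd2 : ∀ k, HasDerivAt (fun t : ℝ => lineProj (slope j (c + t • u)) (k, j)) 0 0 := by
    intro k
    have := (PiLp.hasFDerivAt_apply (𝕜 := ℝ) 2 (E := fun _ : Fin n × Fin n => ℂ) (lineProj (slope j (c + (0 : ℝ) • u)))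
      (k, j)).comp_hasDerivAt (0 : ℝ) hd1
    exact this
  have hval : ∀ (c : Cn n) k, lineProj (slope j c) (k, j) =
      ((‖slope j c‖ ^ 2)⁻¹ : ℝ) * slope j c k := by
    intro c k
    simp [lineProj, outer_apply, slope_same]
  -- away from the index `j` the entries of the slope are quotients of entries of the projection
  have hu : ∀ k, k ≠ j → u k = 0 := by
    intro k hk
    have hmul : (fun t : ℝ => lineProj (slope j (c + t • u)) (k, j)) = fun t : ℝ =>
        (c k + t • u k) * lineProj (slope j (c + t • u)) (j, j) := by
      ext1 t
      rw [hval, hval, slope_same]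
      simp [slope, hk, mul_comm]
    have hlin : HasDerivAt (fun t : ℝ => c k + t • u k) (u k) 0 := by
      simpa using ((hasDerivAt_id (0 : ℝ)).smul_const (u k)).const_add (c k)
    have h3 := hlin.mul (hd2 j)
    have h4 := (hd2 k)
    rw [hmul] at h4
    have h5 := h4.unique h3
    simp only [zero_smul, add_zero, mul_zero, hval, slope_same, mul_one] at h5
    rcases mul_eq_zero.1 h5.symm with h | h
    · exact h
    · exact absurd (by exact_mod_cast h) (inv_ne_zero hσ)
  have hslope : ∀ t : ℝ, slope j (c + t • u) = slope j c := by
    intro t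
    ext k
    by_cases hk : k = j
    · subst hk; simp [slope_same]
    · simp [slope, hk, hu k hk]
  have hd3 := hchain (fun c : Cn n => c j • slope j c)
    ((contDiff_coord_smul_slope j).contDiffAt.differentiableAt (by simp))
  have hd4 : HasDerivAt (fun t : ℝ => (c + t • u) j • slope j (c + t • u)) (u j • slope j c) 0 := by
    simp only [hslope, PiLp.add_apply, PiLp.smul_apply]
    have hlin : HasDerivAt (fun t : ℝ => c j + t • u j) (u j) 0 := by
      simpa using ((hasDerivAt_id (0 : ℝ)).smul_const (u j)).const_add (c j)
    exact hlin.smul_const (slope j c)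
  -- the slope being constant along `u`, the point moves with velocity `u_j` times the slope
  rw [hd3.unique hd4] at h2
  have huj : u j = 0 := by
    simp only [lineForm, smul_apply, radialForm_apply, smul_eq_mul, real_inner_self_eq_norm_sq,
      inner_smul_right] at h2
    have h6 : u j * inner ℂ (slope j c) (slope j c) = 0 := by
      rcases mul_eq_zero.1 h2 with h | h
      · exact absurd h (inv_ne_zero hσ)
      · exact norm_eq_zero.1 (pow_eq_zero_iff (two_ne_zero)|>.1 h)
    rcases mul_eq_zero.1 h6 with h | h
    · exact h
    · exact absurd (inner_self_eq_zero.1 h) (slope_ne j c)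
  ext k
  by_cases hk : k = j
  · subst hk; exact huj
  · exact hu k hk

/-- The form `T |dΠ|² + 2 T' |Π dz|²` is positive definite on the blow-up, on the exceptional divisor
too: it dominates the squared velocities of the line and of the point inside the line. -/
theorem ambientForm_pos {T : ℝ → ℝ} (hT : IsMomentProfile T) (p : BlowUp n)
    (v : TangentSpace 𝓘(ℝ, Cn n) p) (hv : v ≠ 0) :
    0 < ambientForm T p
      (mfderiv 𝓘(ℝ, Cn n) 𝓘(ℝ, Cn n × EuclideanSpace ℂ (Fin n × Fin n)) embed p v)
      (mfderiv 𝓘(ℝ, Cn n) 𝓘(ℝ, Cn n × EuclideanSpace ℂ (Fin n × Fin n)) embed p v) := by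
  obtain ⟨j, hj⟩ := exists_rep_ne p
  -- in the affine chart, `v` becomes the vector `u` and the embedding is explicit
  set c := chartFun j p with hc
  set u : Cn n := mfderiv 𝓘(ℝ, Cn n) 𝓘(ℝ, Cn n) (chartFun j) p v with hu
  have hchart : ContMDiffAt 𝓘(ℝ, Cn n) 𝓘(ℝ, Cn n) ∞ (chartFun j) p :=
    contMDiffAt_of_mem_maximalAtlas (affineChart_mem_maximalAtlas j) hj
  have hloc : (chartInv j ∘ chartFun j) =ᶠ[nhds p] id := by
    filter_upwards [(affineChart j).open_source.mem_nhds hj] with q hq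
    exact chartInv_chartFun j q hq
  have hinv : mfderiv 𝓘(ℝ, Cn n) 𝓘(ℝ, Cn n) (chartInv j) (chartFun j p)
      (mfderiv 𝓘(ℝ, Cn n) 𝓘(ℝ, Cn n) (chartFun j) p v) = v := by
    have h := mfderiv_comp_apply p
      ((contMDiff_chartInv (𝕜 := ℝ) (m := ∞) j (chartFun j p)).mdifferentiableAt (by simp))
      (hchart.mdifferentiableAt (by simp)) v
    rw [hloc.mfderiv_eq, mfderiv_id] at h
    exact h.symm
  have hembed : mfderiv 𝓘(ℝ, Cn n) 𝓘(ℝ, Cn n × EuclideanSpace ℂ (Fin n × Fin n)) embed p v =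
      fderiv ℝ (embed ∘ chartInv j) c u := by
    have h1 : (embed : BlowUp n → _) =ᶠ[nhds p] (embed ∘ chartInv j) ∘ chartFun j := by
      filter_upwards [hloc] with q hq
      exact congrArg embed hq.symm
    refine (congrArg (fun L : Cn n →L[ℝ] Cn n × EuclideanSpace ℂ (Fin n × Fin n) => L v)
      h1.mfderiv_eq).trans ?_
    refine (mfderiv_comp_apply p
      ((contDiff_embed_chartInv j).contMDiff.mdifferentiable (by simp) _)
      (hchart.mdifferentiableAt (by simp)) v).trans ?_
    rw [mfderiv_eq_fderiv]
    rfl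
  have hu0 : u ≠ 0 := by
    intro h
    apply hv
    rw [← hinv, ← hu, h]
    exact map_zero _
  have hfd : fderiv ℝ (embed ∘ chartInv j) c u =
      (fderiv ℝ (fun c : Cn n => c j • slope j c) c u,
        fderiv ℝ (fun c => lineProj (slope j c)) c u) := by
    rw [show (embed ∘ chartInv j : Cn n → _) =
      fun c => (c j • slope j c, lineProj (slope j c)) from funext (embed_chartInv j),
      DifferentiableAt.fderiv_prodMk]
    · rfl
    · exact (contDiff_coord_smul_slope j).contDiffAt.differentiableAt (by simp)
    · exact ((contDiffAt_lineProj (slope_ne j c)).comp c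
        (contDiff_slope_real j).contDiffAt).differentiableAt (by simp)
  have hline : lineForm p.line.rep = lineForm (slope j c) := by
    conv_lhs => rw [← chartInv_chartFun j p hj]
    exact lineForm_rep_mk _ (slope_ne j c)
  have hform := ambientForm_apply T p
    (mfderiv 𝓘(ℝ, Cn n) 𝓘(ℝ, Cn n × EuclideanSpace ℂ (Fin n × Fin n)) embed p v)
    (mfderiv 𝓘(ℝ, Cn n) 𝓘(ℝ, Cn n × EuclideanSpace ℂ (Fin n × Fin n)) embed p v)
  rw [hform, hembed, hfd, hline, real_inner_self_eq_norm_sq]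
  dsimp only
  set X := fderiv ℝ (fun c : Cn n => c j • slope j c) c u
  set Y := fderiv ℝ (fun c => lineProj (slope j c)) c u with hY
  have hT1 := hT.pos (‖p.blowDown‖ ^ 2) (by positivity)
  have hT2 := hT.deriv_pos (‖p.blowDown‖ ^ 2) (by positivity)
  have hX0 : 0 ≤ lineForm (slope j c) X X := by
    simp only [lineForm, smul_apply, radialForm_apply, smul_eq_mul, real_inner_self_eq_norm_sq]
    positivity
  by_cases hY0 : Y = 0
  · have hX1 : lineForm (slope j c) X X ≠ 0 := fun h => hu0 (eq_zero_of_fderiv_slope j c u hY0 h)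
    have : 0 < lineForm (slope j c) X X := lt_of_le_of_ne hX0 hX1.symm
    positivity
  · have : 0 < ‖Y‖ := norm_pos_iff.2 hY0
    positivity

/-- The smooth `U(n)`-invariant metric on the blow-up with moment profile `T`. -/
noncomputable def invariantMetric {T : ℝ → ℝ} (hT : IsMomentProfile T) :
    SmoothMetric n (BlowUp n) :=
  pullbackMetric embed contMDiff_embed (ambientForm T) (contMDiff_ambientForm hT)
    (ambientForm_symm T) (ambientForm_pos hT)

end BlowUp

theorem euclideanMetric_apply {n : ℕ} (v w : Cn n) : euclideanMetric n v w = inner ℝ v w := rfl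

/-- The expression, in the coordinate `z ≠ 0` of `ℂⁿ`, of the `U(n)`-invariant metric with moment
profile `T`. -/
noncomputable def profileForm {n : ℕ} (T : ℝ → ℝ) (z : Cn n) : Cn n →L[ℝ] Cn n →L[ℝ] ℝ :=
  (2 * T (‖z‖ ^ 2) / ‖z‖ ^ 2) • euclideanMetric n +
    (2 * deriv T (‖z‖ ^ 2) / ‖z‖ ^ 2 - 2 * T (‖z‖ ^ 2) / (‖z‖ ^ 2) ^ 2) • radialForm z

/-- The two expressions of the invariant metric agree where `z ≠ 0` is a coordinate: `Π dz` is the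
component of `dz` along `z`, and `|dΠ|²` is given by `real_inner_fderiv_lineProj`. -/
theorem BlowUp.metricInCoordinates_invariantMetric {n : ℕ} [NeZero n] {T : ℝ → ℝ}
    (hT : IsMomentProfile T) {z : Cn n} (hz : z ≠ 0) :
    metricInCoordinates (invariantMetric hT) (blowDownHomeo n) z = profileForm T z := by
  have hval : ∀ y : Cn n, y ≠ 0 → embed (blowUpPoint y) = (y, lineProj y) := by
    intro y hy
    rw [blowUpPoint_of_ne hy]
    exact Prod.ext rfl (lineProj_rep_mk y hy)
  have hloc : (embed ∘ blowUpPoint) =ᶠ[nhds z] fun y => (y, lineProj y) := by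
    filter_upwards [isOpen_ne.mem_nhds hz] with y hy
    exact hval y hy
  have hd : ∀ v : Cn n, mfderiv 𝓘(ℝ, Cn n) 𝓘(ℝ, Cn n × EuclideanSpace ℂ (Fin n × Fin n)) embed
      (blowUpPoint z) (mfderiv 𝓘(ℝ, Cn n) 𝓘(ℝ, Cn n) blowUpPoint z v) =
        (v, fderiv ℝ lineProj z v) := by
    intro v
    refine (mfderiv_comp_apply z (contMDiff_embed.mdifferentiable (by simp) _)
      ((contMDiffAt_blowUpPoint_real hz).mdifferentiableAt (by simp)) v).symm.trans ?_
    refine (congrArg (fun L : Cn n →L[ℝ] Cn n × EuclideanSpace ℂ (Fin n × Fin n) => L v)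
      hloc.mfderiv_eq).trans ?_
    rw [mfderiv_eq_fderiv, DifferentiableAt.fderiv_prodMk (f₁ := fun y : Cn n => y) differentiableAt_id
      ((contDiffAt_lineProj hz).differentiableAt (by simp))]
    simp
  ext v w
  change ambientForm T (blowUpPoint z)
    (mfderiv 𝓘(ℝ, Cn n) 𝓘(ℝ, Cn n × EuclideanSpace ℂ (Fin n × Fin n)) embed
      (blowUpPoint z) (mfderiv 𝓘(ℝ, Cn n) 𝓘(ℝ, Cn n) blowUpPoint z v))
    (mfderiv 𝓘(ℝ, Cn n) 𝓘(ℝ, Cn n × EuclideanSpace ℂ (Fin n × Fin n)) embed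
      (blowUpPoint z) (mfderiv 𝓘(ℝ, Cn n) 𝓘(ℝ, Cn n) blowUpPoint z w)) = _
  rw [hd, hd, ambientForm_apply, real_inner_fderiv_lineProj hz]
  have h1 : (blowUpPoint z).blowDown = z := by rw [blowUpPoint_of_ne hz]; rfl
  have h2 : lineForm (blowUpPoint z).line.rep = lineForm z := by
    rw [blowUpPoint_of_ne hz]; exact lineForm_rep_mk z hz
  rw [h1, h2]
  simp only [profileForm, lineForm, add_apply, smul_apply, smul_eq_mul, radialForm_apply,
    euclideanMetric_apply]
  ring

/-! ### The one-variable potential -/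

/-- The polynomial `(tⁿ - (n - 1) t - 2 + n) / (t - 1)`. -/
noncomputable def denomFactor (n : ℕ) (t : ℝ) : ℝ := ∑ k ∈ Finset.range n, t ^ k - (n - 1)

/-- The polynomial `(denomFactor n t - t ^ (n - 1)) / (t - 1)`. -/
noncomputable def denomRemainder (n : ℕ) (t : ℝ) : ℝ :=
  ∑ k ∈ Finset.range (n - 1), ∑ m ∈ Finset.range k, t ^ m

theorem sub_one_mul_denomFactor (n : ℕ) (t : ℝ) :
    (t - 1) * denomFactor n t = t ^ n - (n - 1) * t - 2 + n := by
  have h := geom_sum_mul t n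
  rw [denomFactor, mul_sub, mul_comm (t - 1), h]
  ring

theorem sub_one_mul_denomRemainder {n : ℕ} (hn : 2 ≤ n) (t : ℝ) :
    (t - 1) * denomRemainder n t = denomFactor n t - t ^ (n - 1) := by
  obtain ⟨m, rfl⟩ : ∃ m, n = m + 1 := ⟨n - 1, by omega⟩
  rw [denomFactor, denomRemainder, Finset.sum_range_succ, Finset.mul_sum]
  simp only [mul_comm (t - 1), geom_sum_mul, Finset.sum_sub_distrib, add_tsub_cancel_right]
  simp
  ring

theorem denomFactor_pos_of_one_le {n : ℕ} {t : ℝ} (ht : 1 ≤ t) : 0 < denomFactor n t := by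
  have h : ∑ k ∈ Finset.range n, (1 : ℝ) ≤ ∑ k ∈ Finset.range n, t ^ k :=
    Finset.sum_le_sum fun k _ => one_le_pow₀ ht
  simp only [Finset.sum_const, Finset.card_range, nsmul_eq_mul, mul_one] at h
  rw [denomFactor]
  linarith

theorem contDiff_denomFactor (n : ℕ) : ContDiff ℝ ∞ (denomFactor n) := by
  unfold denomFactor; fun_prop

theorem contDiff_denomRemainder (n : ℕ) : ContDiff ℝ ∞ (denomRemainder n) := by
  unfold denomRemainder; fun_prop

/-- The polynomial stays positive somewhat to the left of `t = 1`. -/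
theorem exists_denomFactor_pos (n : ℕ) :
    ∃ τ : ℝ, 0 < τ ∧ τ < 1 ∧ ∀ t, τ < t → 0 < denomFactor n t := by
  have h := (contDiff_denomFactor n).continuous.continuousAt (x := 1) |>.eventually
    (lt_mem_nhds (denomFactor_pos_of_one_le (n := n) le_rfl))
  obtain ⟨ε, hε, h⟩ := Metric.eventually_nhds_iff.1 h
  refine ⟨max (1 / 2) (1 - ε), by positivity, by simp [hε]; norm_num, fun t ht => ?_⟩
  rcases le_or_gt 1 t with h1 | h1
  · exact denomFactor_pos_of_one_le h1
  · apply h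
    rw [Real.dist_eq, abs_lt]
    have := le_max_right (1 / 2) (1 - ε)
    constructor <;> linarith

/-- The function `F''(t) - 1 / (t - 1)`, which extends smoothly beyond `t = 1`. -/
noncomputable def potentialRemainder (n : ℕ) (t : ℝ) : ℝ :=
  -(denomRemainder n t / denomFactor n t) - 1 / t

theorem potential_deriv_two_eq {n : ℕ} (hn : 2 ≤ n) {t : ℝ} (ht : 1 < t) :
    (((n : ℝ) - 1) * t + 2 - n) / (t * (t ^ n - ((n : ℝ) - 1) * t - 2 + n)) =
      1 / (t - 1) + potentialRemainder n t := by
  have h1 := sub_one_mul_denomFactor n t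
  have h2 := sub_one_mul_denomRemainder hn t
  have h3 := denomFactor_pos_of_one_le (n := n) ht.le
  have ht1 : t - 1 ≠ 0 := by linarith
  have ht0 : t ≠ 0 := by linarith
  have hp : t ^ n = t * t ^ (n - 1) := by rw [← pow_succ']; congr 1; omega
  rw [← h1, potentialRemainder]
  have h4 : ((n : ℝ) - 1) * t + 2 - n = t ^ n - (t - 1) * denomFactor n t := by rw [h1]; ring
  rw [h4, hp]
  have h5 : t ^ (n - 1) = denomFactor n t - (t - 1) * denomRemainder n t := by rw [h2]; ring
  rw [h5]
  field_simp
  ring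

theorem exists_antiderivative {τ a : ℝ} (ha : τ < a) {f : ℝ → ℝ}
    (hf : ContDiffOn ℝ ∞ f (Set.Ioi τ)) :
    ∃ r : ℝ → ℝ, ContDiffOn ℝ ∞ r (Set.Ioi τ) ∧ ∀ t, τ < t → HasDerivAt r (f t) t := by
  have hd : ∀ t, τ < t → HasDerivAt (fun t => ∫ x in a..t, f x) (f t) t := by
    intro t ht
    have hsub : Set.uIcc a t ⊆ Set.Ioi τ := fun x hx =>
      lt_of_lt_of_le (lt_min ha ht) hx.1
    have hc : ContinuousAt f t := (hf.continuousOn).continuousAt (Ioi_mem_nhds ht)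
    refine intervalIntegral.integral_hasDerivAt_right
      (hf.continuousOn.mono hsub).intervalIntegrable ?_ hc
    exact (hf.continuousOn).stronglyMeasurableAtFilter isOpen_Ioi t ht
  refine ⟨_, ?_, hd⟩
  rw [contDiffOn_infty_iff_deriv_of_isOpen isOpen_Ioi]
  exact ⟨fun t ht => (hd t ht).differentiableAt.differentiableWithinAt,
    hf.congr fun t ht => (hd t ht).deriv⟩

theorem contDiffOn_potentialRemainder {n : ℕ} {τ : ℝ} (hτ : 0 < τ)
    (h : ∀ t, τ < t → 0 < denomFactor n t) :
    ContDiffOn ℝ ∞ (potentialRemainder n) (Set.Ioi τ) := by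
  refine ((((contDiff_denomRemainder n).contDiffOn).div (contDiff_denomFactor n).contDiffOn
    fun t ht => (h t ht).ne').neg).sub (contDiffOn_const.div contDiffOn_id fun t ht => ?_)
  exact (hτ.trans ht).ne'

theorem exists_potential {n : ℕ} (hn : 2 ≤ n) : ∃ F, IsBurnsSimancaPotential n F := by
  obtain ⟨τ, hτ0, hτ1, hτ⟩ := exists_denomFactor_pos n
  obtain ⟨r, hr, hr'⟩ := exists_antiderivative hτ1 (contDiffOn_potentialRemainder hτ0 hτ)
  obtain ⟨q, hq, hq'⟩ := exists_antiderivative hτ1 hr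
  -- `q'' = F'' - 1 / (t - 1)`, and `1 / (t - 1)` is the second derivative of `(t - 1) log (t - 1)`
  refine ⟨fun t => (t - 1) * Real.log (t - 1) + q t, ?_, ?_⟩
  · have : (fun t => (t - 1) * Real.log (t - 1) + q t - (t - 1) * Real.log (t - 1)) = q := by
      ext t; ring
    rw [this]
    exact hq.mono fun t ht => lt_of_lt_of_le hτ1 ht
  · intro t ht
    have hlog : ∀ t : ℝ, 1 < t → HasDerivAt (fun t => Real.log (t - 1)) (1 / (t - 1)) t :=
      fun t ht => ((hasDerivAt_id t).sub_const 1).log (by simp; linarith)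
    have h1 : ∀ t : ℝ, 1 < t → HasDerivAt (fun t => (t - 1) * Real.log (t - 1) + q t)
        (Real.log (t - 1) + 1 + r t) t := by
      intro t ht
      refine ((((hasDerivAt_id t).sub_const 1).mul (hlog t ht)).add
        (hq' t (hτ1.trans ht))).congr_deriv ?_
      have : t - 1 ≠ 0 := by linarith
      simp only [id]
      field_simp
    have h2 : deriv (fun t => (t - 1) * Real.log (t - 1) + q t) =ᶠ[nhds t]
        fun t => Real.log (t - 1) + 1 + r t := by
      filter_upwards [Ioi_mem_nhds ht] with u hu
      exact (h1 u hu).deriv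
    rw [h2.deriv_eq, potential_deriv_two_eq hn ht]
    exact (((hlog t ht).add_const 1).add (hr' t (hτ1.trans ht))).deriv

namespace IsBurnsSimancaPotential

variable {n : ℕ} {F : ℝ → ℝ}

theorem contDiffOn (hF : IsBurnsSimancaPotential n F) : ContDiffOn ℝ ∞ F (Set.Ioi 1) := by
  have h1 := hF.smooth.mono (Set.Ioi_subset_Ici_self)
  have h2 : ContDiffOn ℝ ∞ (fun t : ℝ => (t - 1) * Real.log (t - 1)) (Set.Ioi 1) := by
    have h3 : ContDiffOn ℝ ∞ (fun t : ℝ => t - 1) (Set.Ioi 1) := by fun_prop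
    exact h3.mul (h3.log fun t ht => by
      have : (1 : ℝ) < t := ht
      linarith)
  refine (h1.add h2).congr fun t _ => by ring

theorem contDiffOn_deriv (hF : IsBurnsSimancaPotential n F) :
    ContDiffOn ℝ ∞ (deriv F) (Set.Ioi 1) :=
  ((contDiffOn_infty_iff_deriv_of_isOpen isOpen_Ioi).1 hF.contDiffOn).2

theorem hasDerivAt (hF : IsBurnsSimancaPotential n F) {t : ℝ} (ht : 1 < t) :
    HasDerivAt F (deriv F t) t :=
  ((hF.contDiffOn.contDiffAt (Ioi_mem_nhds ht)).differentiableAt (by simp)).hasDerivAt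

/-- The equation for `F''`, together with the differentiability of `F'`. -/
theorem hasDerivAt_deriv (hF : IsBurnsSimancaPotential n F) {t : ℝ} (ht : 1 < t) :
    HasDerivAt (deriv F) ((((n : ℝ) - 1) * t + 2 - n) /
      (t * (t ^ n - ((n : ℝ) - 1) * t - 2 + n))) t := by
  rw [← hF.deriv_two t ht]
  exact ((hF.contDiffOn_deriv.contDiffAt (Ioi_mem_nhds ht)).differentiableAt
    (by simp)).hasDerivAt

/-- The singular part of `F'` at `t = 1` is `log (t - 1)`: the rest extends smoothly past `t = 1`, as
an antiderivative of `potentialRemainder`. -/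
theorem exists_deriv_eq (hn : 2 ≤ n) (hF : IsBurnsSimancaPotential n F) {τ : ℝ} (hτ : τ < 1)
    {r : ℝ → ℝ} (hr : ∀ t, τ < t → HasDerivAt r (potentialRemainder n t) t) :
    ∃ c, ∀ t, 1 < t → deriv F t = Real.log (t - 1) + r t + c := by
  have hd : ∀ t ∈ Set.Ioi (1 : ℝ),
      HasDerivAt (fun t => deriv F t - (Real.log (t - 1) + r t)) 0 t := by
    intro t ht
    have ht' : (1 : ℝ) < t := ht
    have h1 := hF.hasDerivAt_deriv ht
    rw [potential_deriv_two_eq hn ht] at h1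
    have hlog : HasDerivAt (fun t => Real.log (t - 1)) (1 / (t - 1)) t :=
      ((hasDerivAt_id t).sub_const 1).log (by simp; linarith)
    exact (h1.sub (hlog.add (hr t (hτ.trans ht)))).congr_deriv (by ring)
  obtain ⟨c, hc⟩ := isOpen_Ioi.exists_is_const_of_deriv_eq_zero (convex_Ioi (1 : ℝ)).isPreconnected
    (fun t ht => (hd t ht).differentiableAt.differentiableWithinAt) (fun t ht => (hd t ht).deriv)
  exact ⟨c, fun t ht => by have := hc t ht; linarith⟩

theorem deriv_two_nonneg (hn : 2 ≤ n) {t : ℝ} (ht : 1 < t) :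
    0 ≤ (((n : ℝ) - 1) * t + 2 - n) / (t * (t ^ n - ((n : ℝ) - 1) * t - 2 + n)) := by
  rw [← sub_one_mul_denomFactor]
  have h1 := denomFactor_pos_of_one_le (n := n) ht.le
  have h2 : (2 : ℝ) ≤ n := by exact_mod_cast hn
  have h3 : 0 ≤ ((n : ℝ) - 1) * t + 2 - n := by nlinarith
  have h4 : 0 < t - 1 := by linarith
  positivity

theorem monotoneOn_deriv (hn : 2 ≤ n) (hF : IsBurnsSimancaPotential n F) :
    MonotoneOn (deriv F) (Set.Ioi 1) := by
  refine monotoneOn_of_deriv_nonneg (convex_Ioi 1) hF.contDiffOn_deriv.continuousOn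
    (fun t ht => ?_) (fun t ht => ?_)
  · rw [interior_Ioi] at ht
    exact (hF.hasDerivAt_deriv ht).differentiableAt.differentiableWithinAt
  · rw [interior_Ioi] at ht
    rw [(hF.hasDerivAt_deriv ht).deriv]
    exact deriv_two_nonneg hn ht

/-- The squared norm `s = |z|²` as a function of the moment `t` extends to a neighbourhood of
`[1, ∞)` as a smooth function with positive derivative that vanishes at `t = 1`. Its inverse is
the moment profile of the metric with `t`-potential `F`. -/
theorem exists_momentProfile (hn : 2 ≤ n) (hF : IsBurnsSimancaPotential n F) :
    ∃ T : ℝ → ℝ, IsMomentProfile T ∧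
      (∀ s, 0 < s → 1 < T s ∧ T s * Real.exp (1 + deriv F (T s)) = s) ∧
      ∀ t, 1 < t → T (t * Real.exp (1 + deriv F t)) = t ∧
        deriv T (t * Real.exp (1 + deriv F t)) =
          (t ^ n - ((n : ℝ) - 1) * t - 2 + n) / (t ^ n * Real.exp (1 + deriv F t)) := by
  obtain ⟨τ, hτ0, hτ1, hτ⟩ := exists_denomFactor_pos n
  obtain ⟨r, hr, hr'⟩ := exists_antiderivative hτ1 (contDiffOn_potentialRemainder hτ0 hτ)
  obtain ⟨c, hc⟩ := hF.exists_deriv_eq hn hτ1 hr'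
  set E : ℝ → ℝ := fun t => Real.exp (1 + (r t + c)) with hE
  have hEpos : ∀ t, 0 < E t := fun t => Real.exp_pos _
  -- `exp (1 + F') = (t - 1) E`, so that `σ` is the smooth extension of `t exp (1 + F')` to `(τ, ∞)`
  set σ : ℝ → ℝ := fun t => t * (t - 1) * E t with hσ
  have hσF : ∀ t, 1 < t → t * Real.exp (1 + deriv F t) = σ t := by
    intro t ht
    have h1 : 0 < t - 1 := by linarith
    rw [hc t ht, show 1 + (Real.log (t - 1) + r t + c) = Real.log (t - 1) + (1 + (r t + c)) by ring,
      Real.exp_add, Real.exp_log h1]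
    simp only [hσ, hE]
    ring
  have hσd : ∀ t, τ < t → HasDerivAt σ (E t * t ^ n / denomFactor n t) t := by
    intro t ht
    have hEd : HasDerivAt E (E t * potentialRemainder n t) t :=
      ((((hr' t ht).add_const c).const_add 1).exp)
    have h1 := ((hasDerivAt_id t).mul ((hasDerivAt_id t).sub_const 1)).mul hEd
    refine h1.congr_deriv ?_
    have hQ := (hτ t ht).ne'
    have ht0 : t ≠ 0 := (hτ0.trans ht).ne'
    have hp : t ^ n = t * t ^ (n - 1) := by rw [← pow_succ']; congr 1; omega
    have h5 : t ^ (n - 1) = denomFactor n t - (t - 1) * denomRemainder n t := by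
      rw [sub_one_mul_denomRemainder hn t]; ring
    simp only [id, potentialRemainder, Pi.mul_apply]
    rw [hp, h5]
    field_simp
    ring
  have hσd0 : ∀ t, τ < t → 0 < E t * t ^ n / denomFactor n t := fun t ht =>
    div_pos (mul_pos (hEpos t) (pow_pos (hτ0.trans ht) n)) (hτ t ht)
  have hσsm : ContDiffOn ℝ ∞ σ (Set.Ioi τ) := by
    have h1 : ContDiffOn ℝ ∞ (fun t : ℝ => t * (t - 1)) (Set.Ioi τ) := by fun_prop
    exact h1.mul (contDiffOn_const.add (hr.add contDiffOn_const)).exp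
  have hmono : StrictMonoOn σ (Set.Ioi τ) := by
    refine strictMonoOn_of_deriv_pos (convex_Ioi τ) hσsm.continuousOn fun t ht => ?_
    rw [interior_Ioi] at ht
    rw [(hσd t ht).deriv]
    exact hσd0 t ht
  have hσ1 : σ 1 = 0 := by simp [hσ]
  -- every `s ≥ 0` is a value on `[1, ∞)`, since `σ` grows at least linearly there
  have hsurj : ∀ s, 0 ≤ s → ∃ t, 1 ≤ t ∧ σ t = s := by
    intro s hs
    set b := max 2 (s / Real.exp (1 + deriv F 2)) with hb
    have hb2 : 2 ≤ b := le_max_left _ _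
    have hsb : s ≤ σ b := by
      rw [← hσF b (by linarith)]
      have h1 : deriv F 2 ≤ deriv F b := hF.monotoneOn_deriv hn (by norm_num : (1 : ℝ) < 2)
        (by show (1 : ℝ) < b; linarith) hb2
      calc s = s / Real.exp (1 + deriv F 2) * Real.exp (1 + deriv F 2) := by
            field_simp
        _ ≤ b * Real.exp (1 + deriv F b) := by
            gcongr
            exact le_max_right _ _
    have hcont : ContinuousOn σ (Set.Icc 1 b) :=
      hσsm.continuousOn.mono fun t ht => lt_of_lt_of_le hτ1 ht.1
    obtain ⟨t, ht, hts⟩ := intermediate_value_Icc (by linarith : (1 : ℝ) ≤ b) hcont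
      ⟨by rw [hσ1]; exact hs, hsb⟩
    exact ⟨t, ht.1, hts⟩
  set T : ℝ → ℝ := Function.invFunOn σ (Set.Ioi τ) with hT
  have hTσ : ∀ t, τ < t → T (σ t) = t := fun t ht => hmono.injOn.leftInvOn_invFunOn ht
  -- near a value of `σ` the global inverse is the local one
  have hTloc : ∀ t, τ < t → ContDiffAt ℝ ∞ T (σ t) ∧
      HasDerivAt T (E t * t ^ n / denomFactor n t)⁻¹ (σ t) := by
    intro t ht
    have hsm : ContDiffAt ℝ ∞ σ t := hσsm.contDiffAt (Ioi_mem_nhds ht)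
    let f' : ℝ ≃L[ℝ] ℝ := ContinuousLinearEquiv.unitsEquivAut ℝ (Units.mk0 _ (hσd0 t ht).ne')
    have hf' : HasFDerivAt σ (f' : ℝ →L[ℝ] ℝ) t := by
      have h := (hσd t ht).hasFDerivAt
      convert! h using 1
    have hinv := hsm.to_localInverse hf' (by simp)
    have hev : T =ᶠ[nhds (σ t)] hsm.localInverse hf' (by simp) := by
      have h1 := hsm.localInverse_apply_image hf' (by simp)
      have h2 := hinv.continuousAt
      have h3 : ∀ᶠ y in nhds (σ t), τ < hsm.localInverse hf' (by simp) y := by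
        apply h2.eventually
        rw [h1]
        exact Ioi_mem_nhds ht
      have h4 : ∀ᶠ y in nhds (σ t), σ (hsm.localInverse hf' (by simp) y) = y :=
        (hsm.hasStrictFDerivAt' hf' (by simp)).eventually_right_inverse
      filter_upwards [h3, h4] with y hy1 hy2
      conv_lhs => rw [← hy2]
      exact hTσ _ hy1
    have hTs : ContDiffAt ℝ ∞ T (σ t) := hinv.congr_of_eventuallyEq hev
    refine ⟨hTs, ?_⟩
    have h5 := (hTs.differentiableAt (by simp)).hasDerivAt
    have h6 := h5.comp t (hσd t ht)
    have h7 : HasDerivAt (T ∘ σ) 1 t := by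
      refine (hasDerivAt_id t).congr_of_eventuallyEq ?_
      filter_upwards [Ioi_mem_nhds ht] with y hy
      exact hTσ y hy
    refine h5.congr_deriv ?_
    exact eq_inv_of_mul_eq_one_left (h6.unique h7)
  refine ⟨T, ⟨?_, ?_, ?_⟩, ?_, ?_⟩
  · intro s hs
    obtain ⟨t, ht, rfl⟩ := hsurj s hs
    exact (hTloc t (lt_of_lt_of_le hτ1 ht)).1
  · intro s hs
    obtain ⟨t, ht, rfl⟩ := hsurj s hs
    rw [hTσ t (lt_of_lt_of_le hτ1 ht)]
    linarith
  · intro s hs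
    obtain ⟨t, ht, rfl⟩ := hsurj s hs
    rw [(hTloc t (lt_of_lt_of_le hτ1 ht)).2.deriv]
    exact inv_pos.2 (hσd0 t (lt_of_lt_of_le hτ1 ht))
  · intro s hs
    obtain ⟨t, ht, rfl⟩ := hsurj s hs.le
    have ht1 : 1 < t := by
      rcases ht.lt_or_eq with h | h
      · exact h
      · rw [← h, hσ1] at hs; exact absurd hs (lt_irrefl 0)
    rw [hTσ t (hτ1.trans ht1)]
    exact ⟨ht1, hσF t ht1⟩
  · intro t ht
    have htτ := hτ1.trans ht
    refine ⟨by rw [hσF t ht]; exact hTσ t htτ, ?_⟩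
    have h1 : Real.exp (1 + deriv F t) = (t - 1) * E t := by
      have h2 := hσF t ht
      have ht0 : t ≠ 0 := by linarith
      apply mul_left_cancel₀ ht0
      rw [h2]
      simp only [hσ]
      ring
    rw [hσF t ht, (hTloc t htτ).2.deriv, h1, ← sub_one_mul_denomFactor]
    have h3 : t - 1 ≠ 0 := by linarith
    have h4 := (hEpos t).ne'
    have h5 : t ≠ 0 := by linarith
    field_simp

/-- `F'` converges at infinity with rate `t ^ (1 - n)`. -/
theorem exists_deriv_limit (hn : 2 ≤ n) (hF : IsBurnsSimancaPotential n F) :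
    ∃ c : ℝ, ∃ t₀ : ℝ, 1 < t₀ ∧ ∀ t, t₀ ≤ t → t ^ n / 2 ≤ t ^ n - ((n : ℝ) - 1) * t - 2 + n ∧
      0 ≤ c - deriv F t ∧ c - deriv F t ≤ 2 / t ^ (n - 1) := by
  have hn' : (2 : ℝ) ≤ n := by exact_mod_cast hn
  obtain ⟨t₁, ht₁⟩ : ∃ t₁ : ℝ, ∀ t, t₁ ≤ t → 2 * ((n : ℝ) - 1) ≤ t ^ (n - 1) :=
    Filter.eventually_atTop.1
      ((Filter.tendsto_pow_atTop (by omega)).eventually (Filter.eventually_ge_atTop _))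
  have hP : ∀ t, max 2 t₁ ≤ t → t ^ n / 2 ≤ t ^ n - ((n : ℝ) - 1) * t - 2 + n := by
    intro t ht
    have h1 := ht₁ t ((le_max_right _ _).trans ht)
    have h2 : 2 ≤ t := (le_max_left _ _).trans ht
    have hp : t ^ n = t * t ^ (n - 1) := by rw [← pow_succ']; congr 1; omega
    rw [hp]
    nlinarith
  -- since `F'' ≤ 2 (n - 1) t ^ (-n)` where the denominator is at least `t ^ (n + 1) / 2`,
  -- `F' + 2 t ^ (1 - n)` decreases
  have hanti : AntitoneOn (fun t => deriv F t + 2 / t ^ (n - 1)) (Set.Ici (max 2 t₁)) := by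
    have hd : ∀ t, max 2 t₁ ≤ t → HasDerivAt (fun t => deriv F t + 2 / t ^ (n - 1))
        ((((n : ℝ) - 1) * t + 2 - n) / (t * (t ^ n - ((n : ℝ) - 1) * t - 2 + n)) -
          2 * (n - 1) / t ^ n) t := by
      intro t ht
      have h2 : 2 ≤ t := (le_max_left _ _).trans ht
      have h3 := (hasDerivAt_pow (n - 1) t).inv (by positivity)
      refine ((hF.hasDerivAt_deriv (by linarith)).add (h3.const_mul 2)).congr_deriv ?_
      obtain ⟨m, rfl⟩ : ∃ m, n = m + 2 := ⟨n - 2, by omega⟩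
      simp only [show m + 2 - 1 = m + 1 by omega, add_tsub_cancel_right]
      push_cast
      have : t ≠ 0 := by linarith
      field_simp
      ring
    refine antitoneOn_of_deriv_nonpos (convex_Ici _)
      (fun t ht => (hd t ht).continuousAt.continuousWithinAt) (fun t ht => ?_) fun t ht => ?_
    · exact (hd t (interior_subset ht)).differentiableAt.differentiableWithinAt
    · have ht' : max 2 t₁ ≤ t := interior_subset ht
      rw [(hd t ht').deriv, sub_nonpos]
      have h2 : 2 ≤ t := (le_max_left _ _).trans ht'
      have h4 := hP t ht'
      have h5 : 0 < t ^ n := by positivity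
      rw [div_le_div_iff₀ (mul_pos (by linarith) (by linarith)) h5]
      have h6 : (((n : ℝ) - 1) * t + 2 - n) ≤ ((n : ℝ) - 1) * t := by linarith
      calc _ ≤ ((n : ℝ) - 1) * t * t ^ n := by gcongr
        _ = 2 * ((n : ℝ) - 1) * (t * (t ^ n / 2)) := by ring
        _ ≤ _ := by
          have : 0 ≤ (n : ℝ) - 1 := by linarith
          gcongr
  have hub : ∀ t, max 2 t₁ ≤ t → ∀ u, max 2 t₁ ≤ u → deriv F u ≤ deriv F t + 2 / t ^ (n - 1) := by
    intro t ht u hu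
    have ht2 : 2 ≤ t := (le_max_left _ _).trans ht
    have hu2 : 2 ≤ u := (le_max_left _ _).trans hu
    rcases le_total t u with h | h
    · have h1 := hanti ht hu h
      have h2 : 0 ≤ 2 / u ^ (n - 1) := by positivity
      simp only at h1
      linarith
    · have h1 := hF.monotoneOn_deriv hn (by show (1 : ℝ) < u; linarith)
        (by show (1 : ℝ) < t; linarith) h
      have h2 : 0 ≤ 2 / t ^ (n - 1) := by positivity
      linarith
  have hbdd : BddAbove (deriv F '' Set.Ici (max 2 t₁)) :=
    ⟨_, by rintro _ ⟨u, hu, rfl⟩; exact hub _ le_rfl u hu⟩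
  refine ⟨sSup (deriv F '' Set.Ici (max 2 t₁)), max 2 t₁, lt_of_lt_of_le (by norm_num)
    (le_max_left _ _), fun t ht => ⟨hP t ht, ?_, ?_⟩⟩
  · exact sub_nonneg.2 (le_csSup hbdd ⟨t, ht, rfl⟩)
  · rw [sub_le_iff_le_add']
    exact csSup_le ⟨_, t, ht, rfl⟩ (by rintro _ ⟨u, hu, rfl⟩; exact hub t ht u hu)

end IsBurnsSimancaPotential

/-! ### The Hessian of the symplectic potential -/

section Hessian

variable {n : ℕ} {F : ℝ → ℝ}

/-- The function `(n-1) t + 2 - n` over `t (tⁿ - (n-1) t - 2 + n)`, that is, `F''`. -/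
noncomputable def potentialDerivTwo (n : ℕ) (t : ℝ) : ℝ :=
  (((n : ℝ) - 1) * t + 2 - n) / (t * (t ^ n - ((n : ℝ) - 1) * t - 2 + n))

theorem denom_pos {t : ℝ} (ht : 1 < t) : 0 < t ^ n - ((n : ℝ) - 1) * t - 2 + n := by
  rw [← sub_one_mul_denomFactor]
  exact mul_pos (by linarith) (denomFactor_pos_of_one_le ht.le)

theorem one_add_mul_potentialDerivTwo {t : ℝ} (ht : 1 < t) :
    1 + t * potentialDerivTwo n t = t ^ n / (t ^ n - ((n : ℝ) - 1) * t - 2 + n) := by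
  have h1 := (denom_pos (n := n) ht).ne'
  have h2 : t ≠ 0 := by linarith
  have h3 : t ^ n = (t ^ n - ((n : ℝ) - 1) * t - 2 + n) + (((n : ℝ) - 1) * t + 2 - n) := by ring
  rw [potentialDerivTwo]
  generalize t ^ n - ((n : ℝ) - 1) * t - 2 + n = D at *
  rw [h3]
  field_simp

theorem isOpen_polytopeInterior : IsOpen (polytopeInterior n) := by
  have : polytopeInterior n = (⋂ i, {x | 0 < x i}) ∩ {x | 0 < ∑ i, x i - 1} := by
    ext x; simp [polytopeInterior]
  rw [this]
  exact (isOpen_iInter_of_finite fun i => isOpen_lt continuous_const (continuous_apply i)).inter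
    (isOpen_lt continuous_const (by fun_prop))

theorem one_lt_sum {x : Fin n → ℝ} (hx : x ∈ polytopeInterior n) : 1 < ∑ i, x i := by
  have := hx.2; linarith

theorem hasFDerivAt_sum_coord (x : Fin n → ℝ) :
    HasFDerivAt (fun x : Fin n → ℝ => ∑ i, x i)
      (∑ i, ContinuousLinearMap.proj (R := ℝ) (φ := fun _ : Fin n => ℝ) i) x :=
  HasFDerivAt.fun_sum fun i _ => hasFDerivAt_apply i x

/-- The Legendre transform `∂g/∂x_i = ½ (log x_i + 1 + F')`, that is, `|z_i|² = x_i exp (1 + F')`. -/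
theorem legendre_eq (hF : IsBurnsSimancaPotential n F) {x : Fin n → ℝ}
    (hx : x ∈ polytopeInterior n) (i : Fin n) :
    legendre F i x = (Real.log (x i) + 1 + deriv F (∑ i, x i)) / 2 := by
  have h1 : ∀ k, HasFDerivAt (fun x : Fin n → ℝ => x k * Real.log (x k))
      ((Real.log (x k) + 1) • ContinuousLinearMap.proj (R := ℝ) (φ := fun _ : Fin n => ℝ) k) x :=
    fun k => HasDerivAt.comp_hasFDerivAt (f := fun x : Fin n → ℝ => x k) x
      (Real.hasDerivAt_mul_log (hx.1 k).ne') (hasFDerivAt_apply (𝕜 := ℝ) k x)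
  have h2 := (hF.hasDerivAt (one_lt_sum hx)).comp_hasFDerivAt x (hasFDerivAt_sum_coord x)
  have h3 := ((HasFDerivAt.fun_sum fun k (_ : k ∈ Finset.univ) => h1 k).add h2).const_mul (1 / 2)
  have h4 : fderiv ℝ (symplecticPotential F) x = _ := h3.fderiv
  rw [legendre, h4]
  simp [sum_apply, Pi.single_apply]
  ring

theorem hasFDerivAt_legendre (hF : IsBurnsSimancaPotential n F) {x : Fin n → ℝ}
    (hx : x ∈ polytopeInterior n) (i : Fin n) :
    HasFDerivAt (legendre F i) ((1 / 2 : ℝ) •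
      ((x i)⁻¹ • ContinuousLinearMap.proj (R := ℝ) (φ := fun _ : Fin n => ℝ) i +
        potentialDerivTwo n (∑ i, x i) •
          ∑ i, ContinuousLinearMap.proj (R := ℝ) (φ := fun _ : Fin n => ℝ) i)) x := by
  have h1 := (hasFDerivAt_apply (𝕜 := ℝ) (F' := fun _ : Fin n => ℝ) i x).log (hx.1 i).ne'
  have h2 := (hF.hasDerivAt_deriv (one_lt_sum hx)).comp_hasFDerivAt x (hasFDerivAt_sum_coord x)
  have h3 := ((h1.add_const 1).add h2).const_mul (1 / 2)
  refine h3.congr_of_eventuallyEq ?_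
  filter_upwards [isOpen_polytopeInterior.mem_nhds hx] with y hy
  rw [legendre_eq hF hy]
  simp
  ring

theorem potentialHessian_apply (hF : IsBurnsSimancaPotential n F) {x : Fin n → ℝ}
    (hx : x ∈ polytopeInterior n) (i j : Fin n) :
    potentialHessian F x i j =
      ((if i = j then (x i)⁻¹ else 0) + potentialDerivTwo n (∑ i, x i)) / 2 := by
  simp only [potentialHessian, Matrix.of_apply]
  rw [(hasFDerivAt_legendre hF hx i).fderiv]
  simp only [smul_apply, add_apply, sum_apply, ContinuousLinearMap.proj_apply, Pi.single_apply,
    Finset.sum_ite_eq', Finset.mem_univ, if_true, smul_eq_mul]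
  split_ifs <;> ring

theorem potentialHessian_mulVec (hF : IsBurnsSimancaPotential n F) {x : Fin n → ℝ}
    (hx : x ∈ polytopeInterior n) (v : Fin n → ℝ) (i : Fin n) :
    (potentialHessian F x).mulVec v i =
      (v i / x i + potentialDerivTwo n (∑ i, x i) * ∑ i, v i) / 2 := by
  simp only [Matrix.mulVec, dotProduct, potentialHessian_apply hF hx, Finset.mul_sum]
  have : ∀ j, ((if i = j then (x i)⁻¹ else 0) + potentialDerivTwo n (∑ i, x i)) / 2 * v j =
      (if i = j then (x i)⁻¹ * v j / 2 else 0) + potentialDerivTwo n (∑ i, x i) * v j / 2 := by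
    intro j; split_ifs <;> ring
  simp only [this, Finset.sum_add_distrib, Finset.sum_ite_eq, Finset.mem_univ, if_true,
    ← Finset.sum_div]
  ring

/-- The Hessian is diagonal plus a matrix of rank one; its inverse is given by the Sherman–Morrison
formula. -/
theorem potentialHessian_mul (hF : IsBurnsSimancaPotential n F) {x : Fin n → ℝ}
    (hx : x ∈ polytopeInterior n) :
    potentialHessian F x * Matrix.of (fun i j => 2 * ((if i = j then x i else 0) -
      potentialDerivTwo n (∑ i, x i) / (1 + (∑ i, x i) * potentialDerivTwo n (∑ i, x i)) *
        (x i * x j))) = 1 := by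
  have hne : 1 + (∑ i, x i) * potentialDerivTwo n (∑ i, x i) ≠ 0 := by
    rw [one_add_mul_potentialDerivTwo (one_lt_sum hx)]
    have h1 := one_lt_sum hx
    exact (div_pos (pow_pos (by linarith) n) (denom_pos (n := n) h1)).ne'
  ext i j
  rw [Matrix.mul_apply]
  have h := potentialHessian_mulVec hF hx (fun k => 2 * ((if k = j then x k else 0) -
      potentialDerivTwo n (∑ i, x i) / (1 + (∑ i, x i) * potentialDerivTwo n (∑ i, x i)) *
        (x k * x j))) i
  simp only [Matrix.mulVec, dotProduct] at h
  simp only [Matrix.of_apply]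
  rw [h, ← Finset.mul_sum, Finset.sum_sub_distrib, ← Finset.mul_sum, ← Finset.sum_mul]
  simp only [Finset.sum_ite_eq', Finset.mem_univ, if_true, Matrix.one_apply]
  have hxi := (hx.1 i).ne'
  clear h
  generalize potentialDerivTwo n (∑ i, x i) = f at *
  generalize (∑ i, x i) = t at *
  have hκ : f / (1 + t * f) * (1 + t * f) = f := div_mul_cancel₀ _ hne
  generalize f / (1 + t * f) = κ at *
  split_ifs with hij
  · subst hij
    have h1 : 2 * (x i - κ * (x i * x i)) / x i = 2 - 2 * κ * x i := by field_simp
    rw [h1]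
    linear_combination (-x i) * hκ
  · have h1 : 2 * (0 - κ * (x i * x j)) / x i = -2 * κ * x j := by field_simp; ring
    rw [h1]
    linear_combination (-x j) * hκ

/-- The entries `G^ij = 2 (δ_ij x_i - F'' / (1 + t F'') x_i x_j)` of the inverse Hessian. -/
theorem inv_potentialHessian (hF : IsBurnsSimancaPotential n F) {x : Fin n → ℝ}
    (hx : x ∈ polytopeInterior n) :
    (potentialHessian F x)⁻¹ = Matrix.of (fun i j => 2 * ((if i = j then x i else 0) -
      potentialDerivTwo n (∑ i, x i) / (1 + (∑ i, x i) * potentialDerivTwo n (∑ i, x i)) *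
        (x i * x j))) :=
  Matrix.inv_eq_right_inv (potentialHessian_mul hF hx)

theorem toricMetric_eq (hF : IsBurnsSimancaPotential n F) {x : Fin n → ℝ}
    (hx : x ∈ polytopeInterior n) (v w : (Fin n → ℝ) × (Fin n → ℝ)) :
    toricMetric F x v w =
      (∑ i, v.1 i * w.1 i / x i + potentialDerivTwo n (∑ i, x i) *
        ((∑ i, v.1 i) * ∑ i, w.1 i)) / 2 +
      2 * (∑ i, x i * (v.2 i * w.2 i) -
        potentialDerivTwo n (∑ i, x i) / (1 + (∑ i, x i) * potentialDerivTwo n (∑ i, x i)) *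
          ((∑ i, x i * v.2 i) * ∑ i, x i * w.2 i)) := by
  rw [toricMetric, inv_potentialHessian hF hx]
  congr 1
  · simp only [dotProduct, potentialHessian_mulVec hF hx]
    generalize potentialDerivTwo n (∑ i, x i) = f
    have h1 : f * ((∑ i, v.1 i) * ∑ i, w.1 i) = ∑ i, v.1 i * (f * ∑ i, w.1 i) := by
      rw [← Finset.sum_mul]; ring
    rw [h1, ← Finset.sum_add_distrib, Finset.sum_div]
    exact Finset.sum_congr rfl fun i _ => by ring
  · have h : ∀ i, (Matrix.of (fun i j => 2 * ((if i = j then x i else 0) -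
        potentialDerivTwo n (∑ i, x i) / (1 + (∑ i, x i) * potentialDerivTwo n (∑ i, x i)) *
        (x i * x j)))).mulVec w.2 i = 2 * (x i * w.2 i -
        potentialDerivTwo n (∑ i, x i) / (1 + (∑ i, x i) * potentialDerivTwo n (∑ i, x i)) *
        x i * ∑ j, x j * w.2 j) := by
      intro i
      simp only [Matrix.mulVec, dotProduct, Matrix.of_apply, mul_sub, sub_mul,
        Finset.sum_sub_distrib, mul_ite, ite_mul, mul_zero, zero_mul, Finset.sum_ite_eq,
        Finset.mem_univ, if_true, Finset.mul_sum]
      congr 1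
      · ring
      · exact Finset.sum_congr rfl fun j _ => by ring
    simp only [dotProduct, h]
    generalize potentialDerivTwo n (∑ i, x i) / _ = κ
    generalize ∑ j, x j * w.2 j = S
    have h1 : κ * ((∑ i, x i * v.2 i) * S) = ∑ i, x i * v.2 i * (κ * S) := by
      rw [← Finset.sum_mul]; ring
    rw [h1, ← Finset.sum_sub_distrib, Finset.mul_sum]
    exact Finset.sum_congr rfl fun i _ => by ring

end Hessian

/-! ### The torus orbit -/

section Toric

variable {n : ℕ} {F : ℝ → ℝ}

theorem toricVector_apply (xy : (Fin n → ℝ) × (Fin n → ℝ)) (i : Fin n) :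
    toricVector F xy i = Complex.exp (legendre F i xy.1 + Complex.I * xy.2 i) := rfl

/-- The derivative of `toricVector`: the vector with entries `z_i ((G v₁)_i + √-1 (v₂)_i)`. -/
noncomputable def toricDeriv (F : ℝ → ℝ) (xy v : (Fin n → ℝ) × (Fin n → ℝ)) : Cn n :=
  WithLp.toLp 2 fun i => toricVector F xy i *
    ((potentialHessian F xy.1).mulVec v.1 i + Complex.I * v.2 i)

theorem hasFDerivAt_toricVector (hF : IsBurnsSimancaPotential n F)
    {xy : (Fin n → ℝ) × (Fin n → ℝ)} (hx : xy.1 ∈ polytopeInterior n) :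
    ∃ L : (Fin n → ℝ) × (Fin n → ℝ) →L[ℝ] Cn n,
      HasFDerivAt (toricVector F) L xy ∧ ∀ v, L v = toricDeriv F xy v := by
  have h1 : ∀ i, ∃ L : (Fin n → ℝ) × (Fin n → ℝ) →L[ℝ] ℂ,
      HasFDerivAt (fun xy => toricVector F xy i) L xy ∧ ∀ v, L v = toricDeriv F xy v i := by
    intro i
    have h2 := (hasFDerivAt_legendre hF hx i).comp xy hasFDerivAt_fst
    have h3 := Complex.ofRealCLM.hasFDerivAt.comp xy h2
    have h4 := (hasFDerivAt_apply (𝕜 := ℝ) (F' := fun _ : Fin n => ℝ) i xy.2).comp xy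
      hasFDerivAt_snd
    have h5 := (Complex.ofRealCLM.hasFDerivAt.comp xy h4).const_mul Complex.I
    have h6 := (h3.add h5).cexp
    refine ⟨_, h6, fun v => ?_⟩
    simp only [toricDeriv, potentialHessian_mulVec hF hx, toricVector_apply]
    simp
    ring
  choose L hL hLv using h1
  refine ⟨(PiLp.continuousLinearEquiv 2 ℝ (fun _ : Fin n => ℂ)).symm.toContinuousLinearMap.comp
    (ContinuousLinearMap.pi L), ?_, fun v => ?_⟩
  · exact ((PiLp.continuousLinearEquiv 2 ℝ
      (fun _ : Fin n => ℂ)).symm.toContinuousLinearMap.hasFDerivAt).comp xy (hasFDerivAt_pi.2 hL)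
  · ext i
    exact hLv i v

theorem norm_sq_toricVector_apply (hF : IsBurnsSimancaPotential n F)
    {xy : (Fin n → ℝ) × (Fin n → ℝ)} (hx : xy.1 ∈ polytopeInterior n) (i : Fin n) :
    ‖toricVector F xy i‖ ^ 2 = xy.1 i * Real.exp (1 + deriv F (∑ i, xy.1 i)) := by
  rw [toricVector_apply, Complex.norm_exp, ← Real.exp_nat_mul, legendre_eq hF hx]
  have h : ((2 : ℕ) : ℝ) * ((((Real.log (xy.1 i) + 1 + deriv F (∑ i, xy.1 i)) / 2 : ℝ) : ℂ) +
      Complex.I * (xy.2 i : ℂ)).re =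
      Real.log (xy.1 i) + (1 + deriv F (∑ i, xy.1 i)) := by
    simp
    ring
  rw [h, Real.exp_add, Real.exp_log (hx.1 i)]

theorem norm_sq_toricVector (hF : IsBurnsSimancaPotential n F)
    {xy : (Fin n → ℝ) × (Fin n → ℝ)} (hx : xy.1 ∈ polytopeInterior n) :
    ‖toricVector F xy‖ ^ 2 = (∑ i, xy.1 i) * Real.exp (1 + deriv F (∑ i, xy.1 i)) := by
  rw [EuclideanSpace.norm_sq_eq, Finset.sum_mul]
  exact Finset.sum_congr rfl fun i _ => norm_sq_toricVector_apply hF hx i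

/-- The moment profile of a metric in terms of its `t`-potential: `T` is the inverse of the
function `t ↦ t exp (1 + F' t)`, and its derivative is given by the differential equation for
`F''`. -/
structure IsMomentProfileOf (n : ℕ) (F T : ℝ → ℝ) : Prop extends IsMomentProfile T where
  one_lt : ∀ s, 0 < s → 1 < T s
  mul_exp : ∀ s, 0 < s → T s * Real.exp (1 + deriv F (T s)) = s
  apply_mul_exp : ∀ t, 1 < t → T (t * Real.exp (1 + deriv F t)) = t
  deriv_mul_exp : ∀ t, 1 < t → deriv T (t * Real.exp (1 + deriv F t)) =
    (Real.exp (1 + deriv F t) * (1 + t * potentialDerivTwo n t))⁻¹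

theorem real_inner_add_I_mul (a b c d : ℝ) :
    inner ℝ ((a : ℂ) + Complex.I * b) ((c : ℂ) + Complex.I * d) = a * c + b * d := by
  rw [Complex.inner]
  simp
  ring

/-- In symplectic coordinates the invariant metric with moment profile the inverse of
`t ↦ t exp (1 + F' t)` is the toric metric `∑ G_ij dx_i dx_j + ∑ G^ij dy_i dy_j`. -/
theorem profileForm_toricDeriv (hF : IsBurnsSimancaPotential n F) {T : ℝ → ℝ}
    (hT : IsMomentProfileOf n F T) {xy : (Fin n → ℝ) × (Fin n → ℝ)}
    (hx : xy.1 ∈ polytopeInterior n) (v w : (Fin n → ℝ) × (Fin n → ℝ)) :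
    profileForm T (toricVector F xy) (toricDeriv F xy v) (toricDeriv F xy w) =
      toricMetric F xy.1 v w := by
  have ht := one_lt_sum hx
  set f := potentialDerivTwo n (∑ i, xy.1 i) with hf
  set e := Real.exp (1 + deriv F (∑ i, xy.1 i)) with he
  have he0 : 0 < e := Real.exp_pos _
  have hz : ∀ i, (starRingEnd ℂ) (toricVector F xy i) * toricVector F xy i =
      ((xy.1 i * e : ℝ) : ℂ) := fun i => by
    rw [mul_comm, Complex.mul_conj, Complex.normSq_eq_norm_sq, norm_sq_toricVector_apply hF hx i]
  -- `⟨z, dz⟩ = e (½ (1 + t f) dt + √-1 ∑ x_i dy_i)`, where `e = |z_i|² / x_i`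
  have hin : ∀ v : (Fin n → ℝ) × (Fin n → ℝ), inner ℂ (toricVector F xy) (toricDeriv F xy v) =
      ((e * ((1 + (∑ i, xy.1 i) * f) * (∑ i, v.1 i) / 2) : ℝ) : ℂ) +
        Complex.I * ((e * ∑ i, xy.1 i * v.2 i : ℝ) : ℂ) := by
    intro v
    have h1 : (1 + (∑ i, xy.1 i) * f) * (∑ i, v.1 i) / 2 =
        ∑ i, xy.1 i * (potentialHessian F xy.1).mulVec v.1 i := by
      simp only [potentialHessian_mulVec hF hx, ← hf]
      rw [add_mul, one_mul, mul_assoc, Finset.sum_mul, ← Finset.sum_add_distrib, Finset.sum_div]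
      refine Finset.sum_congr rfl fun i _ => ?_
      have := (hx.1 i).ne'
      field_simp
    rw [PiLp.inner_apply, h1, Finset.mul_sum, Finset.mul_sum, Complex.ofReal_sum,
      Complex.ofReal_sum, Finset.mul_sum, ← Finset.sum_add_distrib]
    refine Finset.sum_congr rfl fun i _ => ?_
    have h2 := hz i
    simp only [RCLike.inner_apply, toricDeriv]
    push_cast at h2 ⊢
    linear_combination ((potentialHessian F xy.1).mulVec v.1 i + Complex.I * v.2 i) * h2
  -- `|dz|² = e (∑ dx_i² / x_i + 2 f dt² + t f² dt²) / 4 + e ∑ x_i dy_i²`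
  have hin2 : inner ℝ (toricDeriv F xy v) (toricDeriv F xy w) =
      e * ((∑ i, v.1 i * w.1 i / xy.1 i + 2 * f * ((∑ i, v.1 i) * ∑ i, w.1 i) +
        f ^ 2 * (∑ i, xy.1 i) * ((∑ i, v.1 i) * ∑ i, w.1 i)) / 4 +
        ∑ i, xy.1 i * (v.2 i * w.2 i)) := by
    have h1 : ∀ i, inner ℝ (toricDeriv F xy v i) (toricDeriv F xy w i) =
        xy.1 i * e * ((potentialHessian F xy.1).mulVec v.1 i *
          (potentialHessian F xy.1).mulVec w.1 i + v.2 i * w.2 i) := by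
      intro i
      rw [Complex.inner]
      simp only [toricDeriv, map_mul]
      rw [mul_mul_mul_comm, mul_comm (toricVector F xy i), hz, Complex.re_ofReal_mul]
      simp
      left
      ring
    rw [PiLp.inner_apply]
    simp only [h1, potentialHessian_mulVec hF hx, ← hf]
    have h2 : 2 * f * ((∑ i, v.1 i) * ∑ i, w.1 i) =
        ∑ i, (v.1 i * (f * ∑ i, w.1 i) + w.1 i * (f * ∑ i, v.1 i)) := by
      rw [Finset.sum_add_distrib, ← Finset.sum_mul, ← Finset.sum_mul]; ring
    have h3 : f ^ 2 * (∑ i, xy.1 i) * ((∑ i, v.1 i) * ∑ i, w.1 i) =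
        ∑ i, xy.1 i * (f ^ 2 * ((∑ i, v.1 i) * ∑ i, w.1 i)) := by
      rw [← Finset.sum_mul]; ring
    rw [h2, h3, ← Finset.sum_add_distrib, ← Finset.sum_add_distrib, Finset.sum_div,
      ← Finset.sum_add_distrib, Finset.mul_sum _ _ e]
    refine Finset.sum_congr rfl fun i _ => ?_
    have := (hx.1 i).ne'
    field_simp
    ring
  have hpos : 0 < 1 + (∑ i, xy.1 i) * f := by
    rw [hf, one_add_mul_potentialDerivTwo ht]
    exact div_pos (pow_pos (by linarith) n) (denom_pos ht)
  have hT1 := hT.apply_mul_exp _ ht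
  have hT2 := hT.deriv_mul_exp _ ht
  rw [toricMetric_eq hF hx]
  simp only [profileForm, add_apply, smul_apply, smul_eq_mul, euclideanMetric_apply,
    radialForm_apply, hin, hin2, norm_sq_toricVector hF hx, real_inner_add_I_mul]
  rw [← he] at hT1 hT2 ⊢
  rw [hT1, hT2, ← hf]
  clear_value f e
  generalize (∑ i, xy.1 i) = t at *
  have ht0 : 0 < t := by linarith
  field_simp
  ring

/-- Every point of the dense torus orbit has symplectic coordinates. -/
theorem exists_toricVector_eq (hF : IsBurnsSimancaPotential n F) {T : ℝ → ℝ}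
    (hT : IsMomentProfileOf n F T) {z : Cn n} (hz0 : z ≠ 0) (hz : ∀ i, z i ≠ 0) :
    ∃ xy : (Fin n → ℝ) × (Fin n → ℝ), xy.1 ∈ polytopeInterior n ∧ toricVector F xy = z := by
  have hs : 0 < ‖z‖ ^ 2 := by positivity
  have h1 := hT.one_lt _ hs
  have h2 := hT.mul_exp _ hs
  set t := T (‖z‖ ^ 2)
  set e := Real.exp (1 + deriv F t) with he
  have he0 : 0 < e := Real.exp_pos _
  have hsum : ∑ i, ‖z i‖ ^ 2 / e = t := by
    rw [← Finset.sum_div, ← EuclideanSpace.norm_sq_eq, ← h2]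
    field_simp
  have hx : (fun i => ‖z i‖ ^ 2 / e) ∈ polytopeInterior n := by
    refine ⟨fun i => ?_, ?_⟩
    · have := norm_pos_iff.2 (hz i)
      positivity
    · rw [hsum]; linarith
  refine ⟨(fun i => ‖z i‖ ^ 2 / e, fun i => (z i).arg), hx, ?_⟩
  ext i
  rw [toricVector_apply]
  have hl : legendre F i (fun i => ‖z i‖ ^ 2 / e) = Real.log ‖z i‖ := by
    rw [legendre_eq hF hx, hsum, Real.log_div (by have := hz i; positivity) he0.ne', he,
      Real.log_exp, Real.log_pow]
    push_cast
    ring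
  dsimp only
  rw [hl, Complex.exp_add, ← Complex.ofReal_exp, Real.exp_log (norm_pos_iff.2 (hz i)),
    mul_comm Complex.I]
  exact Complex.norm_mul_exp_arg_mul_I (z i)

theorem exists_toricDeriv_eq (hF : IsBurnsSimancaPotential n F)
    {xy : (Fin n → ℝ) × (Fin n → ℝ)} (hx : xy.1 ∈ polytopeInterior n) (u : Cn n) :
    ∃ v, toricDeriv F xy v = u := by
  have hunit : IsUnit (potentialHessian F xy.1).det :=
    Matrix.isUnit_det_of_right_inverse (potentialHessian_mul hF hx)
  refine ⟨((potentialHessian F xy.1)⁻¹.mulVec fun i => (u i / toricVector F xy i).re,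
    fun i => (u i / toricVector F xy i).im), ?_⟩
  ext i
  simp only [toricDeriv]
  rw [Matrix.mulVec_mulVec, Matrix.mul_nonsing_inv _ hunit, Matrix.one_mulVec, mul_comm Complex.I,
    Complex.re_add_im]
  exact mul_div_cancel₀ _ (Complex.exp_ne_zero _)

theorem dense_coord_ne_zero : Dense {z : Cn n | ∀ i, z i ≠ 0} := by
  have h := dense_pi (Set.univ : Set (Fin n)) (fun i _ => dense_compl_singleton (0 : ℂ))
  have h2 := h.preimage (PiLp.homeomorph 2 (fun _ : Fin n => ℂ)).isOpenMap
  convert! h2 using 1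
  ext z
  simp [PiLp.homeomorph]

/-- In the coordinate `z`, the defining property of the metric with `t`-potential `F`. -/
theorem isMetricOfPotential_iff [NeZero n] (hF : IsBurnsSimancaPotential n F)
    (h : SmoothMetric n (BlowUp n)) :
    IsMetricOfPotential F h ↔ ∀ x ∈ polytopeInterior n, ∀ y : Fin n → ℝ,
      ∀ v w : (Fin n → ℝ) × (Fin n → ℝ),
        metricInCoordinates h (BlowUp.blowDownHomeo n) (toricVector F (x, y))
          (toricDeriv F (x, y) v) (toricDeriv F (x, y) w) = toricMetric F x v w := by
  have hfun : toricPoint (n := n) F = BlowUp.blowUpPoint ∘ toricVector F := by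
    ext1 xy
    exact (BlowUp.blowUpPoint_of_ne (toricVector_ne_zero F xy)).symm
  have key : ∀ x ∈ polytopeInterior n, ∀ y v,
      mfderiv 𝓘(ℝ, (Fin n → ℝ) × (Fin n → ℝ)) 𝓘(ℝ, Cn n) (BlowUp.blowUpPoint ∘ toricVector F)
        (x, y) v = mfderiv 𝓘(ℝ, Cn n) 𝓘(ℝ, Cn n) BlowUp.blowUpPoint (toricVector F (x, y))
        (toricDeriv F (x, y) v) := by
    intro x hx y v
    obtain ⟨L, hL, hLv⟩ := hasFDerivAt_toricVector hF (xy := (x, y)) hx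
    have h1 := mfderiv_comp_apply (I := 𝓘(ℝ, (Fin n → ℝ) × (Fin n → ℝ))) (I' := 𝓘(ℝ, Cn n))
      (I'' := 𝓘(ℝ, Cn n)) (x, y)
      ((BlowUp.contMDiffAt_blowUpPoint_real (toricVector_ne_zero F (x, y))).mdifferentiableAt
        (by simp)) hL.hasMFDerivAt.mdifferentiableAt v
    rw [hL.hasMFDerivAt.mfderiv] at h1
    exact h1.trans (congrArg (mfderiv 𝓘(ℝ, Cn n) 𝓘(ℝ, Cn n) BlowUp.blowUpPoint
      (toricVector F (x, y))) (hLv v))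
  unfold IsMetricOfPotential
  rw [hfun]
  refine forall₂_congr fun x hx => forall_congr' fun y => forall₂_congr fun v w => ?_
  rw [key x hx y v, key x hx y w]
  rfl

theorem isMetricOfPotential_invariantMetric [NeZero n] (hF : IsBurnsSimancaPotential n F)
    {T : ℝ → ℝ} (hT : IsMomentProfileOf n F T) :
    IsMetricOfPotential F (BlowUp.invariantMetric (n := n) hT.toIsMomentProfile) := by
  rw [isMetricOfPotential_iff hF]
  intro x hx y v w
  rw [BlowUp.metricInCoordinates_invariantMetric _ (toricVector_ne_zero F (x, y))]
  exact profileForm_toricDeriv hF hT hx v w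

theorem contMDiffOn_blowDownHomeo_symm [NeZero n] :
    ContMDiffOn 𝓘(ℝ, Cn n) 𝓘(ℝ, Cn n) ∞ (BlowUp.blowDownHomeo n).symm
      (BlowUp.blowDownHomeo n).target :=
  fun _ hz => (BlowUp.contMDiffAt_blowUpPoint_real hz).contMDiffWithinAt

/-- The metric is determined off the exceptional divisor by its values on the torus orbit, which
is dense. -/
theorem metricInCoordinates_eq_profileForm [NeZero n] (hF : IsBurnsSimancaPotential n F)
    {T : ℝ → ℝ} (hT : IsMomentProfileOf n F T) {h : SmoothMetric n (BlowUp n)}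
    (hh : IsMetricOfPotential F h) {z : Cn n} (hz : z ≠ 0) :
    metricInCoordinates h (BlowUp.blowDownHomeo n) z = profileForm T z := by
  ext v w
  rw [← BlowUp.metricInCoordinates_invariantMetric hT.toIsMomentProfile hz]
  have hc1 := continuousOn_metricInCoordinates_apply h _ contMDiffOn_blowDownHomeo_symm v w
  have hc2 := continuousOn_metricInCoordinates_apply
    (BlowUp.invariantMetric (n := n) hT.toIsMomentProfile) _ contMDiffOn_blowDownHomeo_symm v w
  have heq : Set.EqOn (fun z => metricInCoordinates h (BlowUp.blowDownHomeo n) z v w)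
      (fun z => metricInCoordinates (BlowUp.invariantMetric (n := n) hT.toIsMomentProfile)
        (BlowUp.blowDownHomeo n) z v w) {z : Cn n | ∀ i, z i ≠ 0} := by
    intro z hz
    have hz0 : z ≠ 0 := fun h => hz 0 (by simp [h])
    obtain ⟨⟨x, y⟩, hx, rfl⟩ := exists_toricVector_eq hF hT hz0 hz
    obtain ⟨v, rfl⟩ := exists_toricDeriv_eq hF hx v
    obtain ⟨w, rfl⟩ := exists_toricDeriv_eq hF hx w
    dsimp only
    rw [(isMetricOfPotential_iff hF h).1 hh x hx, (isMetricOfPotential_iff hF _).1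
      (isMetricOfPotential_invariantMetric hF hT) x hx]
  refine heq.of_subset_closure hc1 hc2 (fun z hz h => hz 0 (by simp [h])) ?_ hz
  rw [dense_coord_ne_zero.closure_eq]
  exact Set.subset_univ _

end Toric

/-! ### Euclidean asymptotics -/

section Asymptotics

variable {n : ℕ} {F : ℝ → ℝ}

theorem IsBurnsSimancaPotential.exists_isMomentProfileOf (hn : 2 ≤ n)
    (hF : IsBurnsSimancaPotential n F) : ∃ T, IsMomentProfileOf n F T := by
  obtain ⟨T, h1, h2, h3⟩ := hF.exists_momentProfile hn
  refine ⟨T, ⟨h1, fun s hs => (h2 s hs).1, fun s hs => (h2 s hs).2, fun t ht => (h3 t ht).1,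
    fun t ht => ?_⟩⟩
  rw [(h3 t ht).2, one_add_mul_potentialDerivTwo ht]
  have := (denom_pos (n := n) ht).ne'
  field_simp

theorem potentialDerivTwo_nonneg (hn : 2 ≤ n) {t : ℝ} (ht : 1 < t) :
    0 ≤ potentialDerivTwo n t := IsBurnsSimancaPotential.deriv_two_nonneg hn ht

/-- The decay `t F'' = O(t ^ (1 - n))`, where the leading term controls the denominator of `F''`. -/
theorem mul_potentialDerivTwo_le (hn : 2 ≤ n) {t : ℝ} (ht : 1 < t)
    (h : t ^ n / 2 ≤ t ^ n - ((n : ℝ) - 1) * t - 2 + n) :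
    t * potentialDerivTwo n t ≤ 2 * (n - 1) / t ^ (n - 1) := by
  have hn' : (2 : ℝ) ≤ n := by exact_mod_cast hn
  have ht0 : 0 < t := by linarith
  have hp : t ^ n = t * t ^ (n - 1) := by rw [← pow_succ']; congr 1; omega
  have h1 : t * potentialDerivTwo n t =
      (((n : ℝ) - 1) * t + 2 - n) / (t ^ n - ((n : ℝ) - 1) * t - 2 + n) := by
    have := (denom_pos (n := n) ht).ne'
    rw [potentialDerivTwo]
    field_simp
  rw [h1]
  calc _ ≤ (((n : ℝ) - 1) * t) / (t ^ n / 2) := by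
        have : 0 ≤ (n : ℝ) - 1 := by linarith
        gcongr
        linarith
    _ = _ := by rw [hp]; field_simp

/-- The metric in coordinates that factor through the blow-down map is a pullback of its
expression in the coordinate `z`. -/
theorem metricInCoordinates_of_symm_eq [NeZero n] (h : SmoothMetric n (BlowUp n))
    (φ : OpenPartialHomeomorph (BlowUp n) (Cn n)) {g : Cn n → Cn n}
    (hφ : ∀ q, φ.symm q = BlowUp.blowUpPoint (g q)) {q : Cn n} {L : Cn n →L[ℝ] Cn n}
    (hL : HasFDerivAt g L q) (hq : g q ≠ 0) (v w : Cn n) :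
    metricInCoordinates h φ q v w =
      metricInCoordinates h (BlowUp.blowDownHomeo n) (g q) (L v) (L w) := by
  have hfun : (φ.symm : Cn n → BlowUp n) = BlowUp.blowUpPoint ∘ g := funext hφ
  have key : ∀ v : Cn n, mfderiv 𝓘(ℝ, Cn n) 𝓘(ℝ, Cn n) (BlowUp.blowUpPoint ∘ g) q v =
      mfderiv 𝓘(ℝ, Cn n) 𝓘(ℝ, Cn n) BlowUp.blowUpPoint (g q) (L v) := by
    intro v
    have h1 := mfderiv_comp_apply (I := 𝓘(ℝ, Cn n)) (I' := 𝓘(ℝ, Cn n)) (I'' := 𝓘(ℝ, Cn n)) q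
      ((BlowUp.contMDiffAt_blowUpPoint_real hq).mdifferentiableAt (by simp))
      hL.hasMFDerivAt.mdifferentiableAt v
    rw [hL.hasMFDerivAt.mfderiv] at h1
    exact h1
  simp only [metricInCoordinates]
  rw [hfun]
  change h.inner (BlowUp.blowUpPoint (g q))
    (mfderiv 𝓘(ℝ, Cn n) 𝓘(ℝ, Cn n) (BlowUp.blowUpPoint ∘ g) q v)
    (mfderiv 𝓘(ℝ, Cn n) 𝓘(ℝ, Cn n) (BlowUp.blowUpPoint ∘ g) q w) = _
  rw [key v, key w]
  rfl

/-- The exceptional divisor is the image of the unit sphere. -/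
theorem isCompact_exceptionalDivisor : IsCompact {p : BlowUp n | p.blowDown = 0} := by
  have hne : ∀ v : Metric.sphere (0 : Cn n) 1, (v : Cn n) ≠ 0 := ne_zero_of_mem_unit_sphere
  let f : Metric.sphere (0 : Cn n) 1 → BlowUp n := fun v =>
    ⟨(0, Projectivization.mk ℂ (v : Cn n) (hne v)), Submodule.zero_mem _⟩
  have hc : Continuous f := by
    refine Continuous.subtype_mk (continuous_const.prodMk ?_) _
    exact BlowUp.isQuotientMap_mk.continuous.comp
      (Continuous.subtype_mk continuous_subtype_val hne)
  have : CompactSpace (Metric.sphere (0 : Cn n) 1) :=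
    isCompact_iff_compactSpace.1 (isCompact_sphere (0 : Cn n) 1)
  suffices hrange : {p : BlowUp n | p.blowDown = 0} = Set.range f by
    rw [hrange]
    exact isCompact_range hc
  ext p
  constructor
  · intro hp
    obtain ⟨⟨z, l⟩, hz⟩ := p
    have hz0 : z = 0 := hp
    subst hz0
    have hr : l.rep ≠ 0 := l.rep_nonzero
    have hn : ‖l.rep‖ ≠ 0 := norm_ne_zero_iff.2 hr
    refine ⟨⟨(‖l.rep‖ : ℂ)⁻¹ • l.rep, ?_⟩, ?_⟩
    · simp [norm_smul, hn]
    · refine Subtype.ext (Prod.ext rfl ?_)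
      change Projectivization.mk ℂ ((‖l.rep‖ : ℂ)⁻¹ • l.rep) _ = l
      conv_rhs => rw [← l.mk_rep]
      rw [Projectivization.mk_eq_mk_iff']
      exact ⟨_, rfl⟩
  · rintro ⟨v, rfl⟩
    rfl

theorem norm_smul_euclideanMetric_sub_smul_radialForm_le {a b : ℝ} (ha : 0 ≤ a) (hb : 0 ≤ b)
    (q : Cn n) : ‖a • euclideanMetric n - b • radialForm q‖ ≤ a + b * ‖q‖ ^ 2 := by
  refine ContinuousLinearMap.opNorm_le_bound₂ _ (by positivity) fun v w => ?_
  simp only [sub_apply, smul_apply, smul_eq_mul]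
  have h1 : |euclideanMetric n v w| ≤ ‖v‖ * ‖w‖ := norm_inner_le_norm (𝕜 := ℝ) v w
  have h2 : |radialForm q v w| ≤ ‖q‖ ^ 2 * ‖v‖ * ‖w‖ :=
    (ContinuousLinearMap.le_opNorm₂ (radialForm q) v w).trans (by
      gcongr; exact norm_radialForm_le q)
  calc _ ≤ |a * euclideanMetric n v w| + |b * radialForm q v w| := abs_sub _ _
    _ = a * |euclideanMetric n v w| + b * |radialForm q v w| := by
      rw [abs_mul, abs_mul, abs_of_nonneg ha, abs_of_nonneg hb]
    _ ≤ a * (‖v‖ * ‖w‖) + b * (‖q‖ ^ 2 * ‖v‖ * ‖w‖) := by gcongr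
    _ = _ := by ring

/-- In the holomorphic coordinate `q = z / ν` the metric is `(e^δ - 1) |dq|²`
minus `e^δ t f / ((1 + t f) |q|²) |⟨q, dq⟩|²` apart from the Euclidean one, where `δ = c - F'`;
both terms are `O(t ^ (1 - n))`, and `t ≥ |q|² / 2`. -/
theorem isAsymptoticallyEuclidean_of_isMetricOfPotential [NeZero n] (hn : 2 ≤ n)
    (hF : IsBurnsSimancaPotential n F) {h : SmoothMetric n (BlowUp n)}
    (hh : IsMetricOfPotential F h) : IsAsymptoticallyEuclidean h (2 - 2 * (n : ℤ)) := by
  obtain ⟨T, hT⟩ := hF.exists_isMomentProfileOf hn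
  obtain ⟨c, t₀, ht₀, hc⟩ := hF.exists_deriv_limit hn
  have hn' : (2 : ℝ) ≤ n := by exact_mod_cast hn
  have hle : ∀ t, 1 < t → deriv F t ≤ c := by
    intro t ht
    have h1 := hF.monotoneOn_deriv hn (show (1 : ℝ) < t from ht)
      (show 1 < max t t₀ from ht.trans_le (le_max_left _ _)) (le_max_left t t₀)
    have h2 := (hc _ (le_max_right t t₀)).2.1
    linarith
  -- at infinity `|z|² = t exp (1 + F')` is asymptotic to `ν² · 2 t`, so that `|z / ν|² ~ 2 t`
  set ν : ℝ := Real.exp ((1 + c) / 2) / √2 with hν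
  have hν0 : 0 < ν := by positivity
  have hν2 : ν ^ 2 = Real.exp (1 + c) / 2 := by
    rw [hν, div_pow, Real.sq_sqrt (by norm_num), ← Real.exp_nat_mul]
    congr 2
    push_cast
    ring
  have hνC : (ν : ℂ)⁻¹ ≠ 0 := inv_ne_zero (by exact_mod_cast hν0.ne')
  set φ : OpenPartialHomeomorph (BlowUp n) (Cn n) :=
    (BlowUp.blowDownHomeo n).transHomeomorph (Homeomorph.smulOfNeZero ((ν : ℂ)⁻¹) hνC) with hφ
  have hsymm : ∀ q, φ.symm q = BlowUp.blowUpPoint (((ν : ℂ)⁻¹)⁻¹ • q) := fun q => rfl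
  have hsource : φ.source = {p | p.blowDown ≠ 0} := rfl
  have htarget : φ.target = {q | q ≠ 0} := by
    ext q
    change ((ν : ℂ)⁻¹)⁻¹ • q ≠ 0 ↔ q ≠ 0
    simp [hν0.ne']
  refine ⟨φ, ?_, ?_, ?_, ?_, ?_⟩
  · rw [hsource]
    convert! isCompact_exceptionalDivisor (n := n) using 1
    ext p; simp
  · rw [htarget]
    convert! isCompact_singleton (x := (0 : Cn n)) using 1
    ext p; simp
  · have h1 : ContDiff ℂ ω fun z : Cn n => (ν : ℂ)⁻¹ • z := by fun_prop
    exact (h1.contMDiff.comp BlowUp.contMDiff_blowDown_complex).contMDiffOn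
  · intro q hq
    have h1 : ContDiff ℂ ω fun z : Cn n => ((ν : ℂ)⁻¹)⁻¹ • z := by fun_prop
    have h2 : ((ν : ℂ)⁻¹)⁻¹ • q ≠ 0 := hq
    exact ((BlowUp.contMDiffAt_blowUpPoint_complex h2).comp q h1.contMDiff.contMDiffAt).contMDiffWithinAt
  · refine Asymptotics.IsBigO.of_bound (2 * n * Real.exp 2 * 2 ^ (n - 1)) ?_
    filter_upwards [eventually_cobounded_le_norm (2 * t₀)] with q hq
    have hqn : 1 < ‖q‖ := by linarith
    have hq0 : q ≠ 0 := norm_pos_iff.1 (by linarith)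
    have hg : HasFDerivAt (fun q : Cn n => ((ν : ℂ)⁻¹)⁻¹ • q)
        (ν • ContinuousLinearMap.id ℝ (Cn n)) q := by
      have h1 := (hasFDerivAt_id (𝕜 := ℝ) q).const_smul ν
      refine h1.congr_of_eventuallyEq (Filter.Eventually.of_forall fun y => ?_)
      ext i
      simp
    have hgq : ((ν : ℂ)⁻¹)⁻¹ • q ≠ 0 := smul_ne_zero (inv_ne_zero hνC) hq0
    have hnorm : ‖((ν : ℂ)⁻¹)⁻¹ • q‖ ^ 2 = ν ^ 2 * ‖q‖ ^ 2 := by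
      rw [inv_inv, norm_smul, mul_pow]; simp
    set s := ν ^ 2 * ‖q‖ ^ 2 with hs
    have hs0 : 0 < s := by positivity
    have ht1 := hT.one_lt s hs0
    have hts := hT.mul_exp s hs0
    have hT' := hT.deriv_mul_exp (T s) ht1
    rw [hts] at hT'
    set t := T s with hTs
    set e := Real.exp (1 + deriv F t) with he
    have he0 : 0 < e := Real.exp_pos _
    set δ := c - deriv F t with hδ
    have heδ : Real.exp (1 + c) = e * Real.exp δ := by
      rw [he, hδ, ← Real.exp_add]; congr 1; ring
    have hδ0 : 0 ≤ δ := sub_nonneg.2 (hle t ht1)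
    have htq' : t = ‖q‖ ^ 2 * Real.exp δ / 2 := by
      have : t * e = e * (‖q‖ ^ 2 * Real.exp δ / 2) := by
        rw [hts, hs, hν2, heδ]; ring
      rw [mul_comm] at this
      exact mul_left_cancel₀ he0.ne' this
    have htq : ‖q‖ ^ 2 / 2 ≤ t := by
      rw [htq']
      have := Real.one_le_exp hδ0
      nlinarith [sq_nonneg ‖q‖]
    have htt₀ : t₀ ≤ t := by nlinarith
    obtain ⟨hP, -, hδ1⟩ := hc t htt₀
    have hf0 := potentialDerivTwo_nonneg hn ht1
    have hf1 := mul_potentialDerivTwo_le hn ht1 hP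
    set f := potentialDerivTwo n t
    clear_value t
    -- `t e = s = ν² |q|²` and `2 ν² = e exp δ`, whence `|q|² = 2 t exp (-δ)`
    have hform : metricInCoordinates h φ q - euclideanMetric n =
        (Real.exp δ - 1) • euclideanMetric n -
          (Real.exp δ * (t * f / (1 + t * f)) / ‖q‖ ^ 2) • radialForm q := by
      ext v w
      rw [sub_apply, sub_apply, metricInCoordinates_of_symm_eq h φ hsymm hg hgq,
        metricInCoordinates_eq_profileForm hF hT hh hgq, profileForm, hnorm, radialForm_smul]
      have hνν : ‖((ν : ℂ)⁻¹)⁻¹‖ ^ 2 = ν ^ 2 := by rw [inv_inv]; simp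
      have hq2 : ‖q‖ ^ 2 = 2 * t / Real.exp δ := by
        rw [htq']
        field_simp
      simp only [add_apply, sub_apply, smul_apply, smul_eq_mul, ContinuousLinearMap.id_apply,
        map_smul, hT', ← hTs, hνν, hq2]
      change _ = _ - _ * radialForm q v w
      have hft1 : 1 + t * f ≠ 0 := by positivity
      have hν2' : ν ^ 2 = e * Real.exp δ / 2 := by rw [hν2, heδ]
      have ht0 : t ≠ 0 := by linarith
      rw [← hts]
      generalize euclideanMetric n v w = E
      generalize radialForm q v w = R
      have hD := Real.exp_pos δ
      generalize Real.exp δ = D at *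
      calc _ = ν ^ 2 * (2 * t / (t * e) * E + (2 * (e * (1 + t * f))⁻¹ / (t * e) -
            2 * t / (t * e) ^ 2) * (ν ^ 2 * R)) - E := by ring
        _ = _ := by
          rw [hν2']
          field_simp
          ring
    rw [hform]
    have hft : 0 ≤ t * f := by positivity
    have hftb : t * f / (1 + t * f) ≤ t * f := div_le_self hft (by linarith)
    have hδ2 : δ ≤ 2 := by
      refine hδ1.trans (div_le_self (by norm_num) (one_le_pow₀ ht1.le))
    -- since `1 - δ ≤ exp (-δ)`, one has `exp δ - 1 ≤ δ exp δ`
    have hexp : Real.exp δ - 1 ≤ Real.exp 2 * δ := by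
      have h1 := Real.one_sub_le_exp_neg δ
      have h2 : Real.exp δ * Real.exp (-δ) = 1 := by rw [← Real.exp_add]; simp
      have h3 : Real.exp δ ≤ Real.exp 2 := Real.exp_le_exp.2 hδ2
      nlinarith [Real.exp_pos δ]
    have hexp0 : 0 ≤ Real.exp δ - 1 := by linarith [Real.one_le_exp hδ0]
    have hqpos : 0 < ‖q‖ ^ 2 := by positivity
    calc ‖(Real.exp δ - 1) • euclideanMetric n -
          (Real.exp δ * (t * f / (1 + t * f)) / ‖q‖ ^ 2) • radialForm q‖
        ≤ (Real.exp δ - 1) + Real.exp δ * (t * f / (1 + t * f)) / ‖q‖ ^ 2 * ‖q‖ ^ 2 :=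
          norm_smul_euclideanMetric_sub_smul_radialForm_le hexp0 (by positivity) q
      _ = (Real.exp δ - 1) + Real.exp δ * (t * f / (1 + t * f)) := by
          rw [div_mul_cancel₀ _ hqpos.ne']
      _ ≤ Real.exp 2 * (2 / t ^ (n - 1)) + Real.exp 2 * (2 * (n - 1) / t ^ (n - 1)) := by
          refine add_le_add (hexp.trans (by gcongr)) (mul_le_mul (Real.exp_le_exp.2 hδ2)
            (hftb.trans hf1) (by positivity) (by positivity))
      _ = 2 * n * Real.exp 2 / t ^ (n - 1) := by ring
      _ ≤ 2 * n * Real.exp 2 / (‖q‖ ^ 2 / 2) ^ (n - 1) := by gcongr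
      _ = 2 * n * Real.exp 2 * 2 ^ (n - 1) * ‖‖q‖ ^ (2 - 2 * (n : ℤ))‖ := by
          have h1 : ‖q‖ ^ (2 - 2 * (n : ℤ)) = ((‖q‖ ^ 2) ^ (n - 1))⁻¹ := by
            rw [← pow_mul, ← zpow_natCast, ← zpow_neg]
            congr 1
            push_cast [Nat.cast_sub (by omega : 1 ≤ n)]
            ring
          rw [h1, Real.norm_of_nonneg (by positivity), div_pow]
          field_simp

end Asymptotics

/-! ### Flat coordinates -/

section Flat

variable {n : ℕ} {F : ℝ → ℝ}

/-- The ratio `|z| / |q|` of the radii in the complex coordinate `z` and the flat coordinate `q`,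
as a function of `t = |q|² / 2`. It is a ratio of vectors too, since `|q_i|² = 2 x_i` and
`|z_i|² = x_i exp (1 + F' t)`, with the same arguments. -/
noncomputable def flatScale (F : ℝ → ℝ) (t : ℝ) : ℝ := Real.exp ((1 + deriv F t) / 2) / √2

theorem flatScale_pos (F : ℝ → ℝ) (t : ℝ) : 0 < flatScale F t := by
  unfold flatScale; positivity

theorem flatScale_sq (F : ℝ → ℝ) (t : ℝ) :
    flatScale F t ^ 2 = Real.exp (1 + deriv F t) / 2 := by
  rw [flatScale, div_pow, Real.sq_sqrt (by norm_num), ← Real.exp_nat_mul]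
  congr 2
  push_cast
  ring

theorem contDiffAt_flatScale (hF : IsBurnsSimancaPotential n F) {t : ℝ} (ht : 1 < t) :
    ContDiffAt ℝ ∞ (flatScale F) t :=
  (((contDiffAt_const.add (hF.contDiffOn_deriv.contDiffAt (Ioi_mem_nhds ht))).div_const 2).exp).div_const _

theorem hasDerivAt_flatScale (hF : IsBurnsSimancaPotential n F) {t : ℝ} (ht : 1 < t) :
    HasDerivAt (flatScale F) (flatScale F t * (potentialDerivTwo n t / 2)) t := by
  have h := ((((hF.hasDerivAt_deriv ht).const_add 1).div_const 2).exp).div_const √2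
  refine h.congr_deriv ?_
  rw [flatScale, potentialDerivTwo]
  ring

/-- The point with flat coordinates `q` in the coordinate `z`. -/
noncomputable def ofFlat (F : ℝ → ℝ) (q : Cn n) : Cn n := flatScale F (‖q‖ ^ 2 / 2) • q

/-- The flat coordinates of the point with coordinate `z`. -/
noncomputable def toFlat (F T : ℝ → ℝ) (z : Cn n) : Cn n :=
  (flatScale F (T (‖z‖ ^ 2)))⁻¹ • z

theorem norm_sq_ofFlat (F : ℝ → ℝ) (q : Cn n) :
    ‖ofFlat F q‖ ^ 2 = ‖q‖ ^ 2 / 2 * Real.exp (1 + deriv F (‖q‖ ^ 2 / 2)) := by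
  rw [ofFlat, norm_smul, mul_pow, Real.norm_eq_abs, sq_abs, flatScale_sq]
  ring

theorem norm_sq_toFlat {T : ℝ → ℝ} (hT : IsMomentProfileOf n F T) {z : Cn n} (hz : z ≠ 0) :
    ‖toFlat F T z‖ ^ 2 / 2 = T (‖z‖ ^ 2) := by
  have hs : 0 < ‖z‖ ^ 2 := by positivity
  have h := hT.mul_exp _ hs
  rw [toFlat, norm_smul, mul_pow, Real.norm_eq_abs, sq_abs, inv_pow, flatScale_sq]
  nth_rewrite 2 [← h]
  field_simp

theorem contDiffAt_ofFlat (hF : IsBurnsSimancaPotential n F) {q : Cn n} (hq : 1 < ‖q‖ ^ 2 / 2) :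
    ContDiffAt ℝ ∞ (ofFlat F) q := by
  have h1 : ContDiffAt ℝ ∞ (fun q : Cn n => ‖q‖ ^ 2 / 2) q :=
    (contDiff_norm_sq ℝ).contDiffAt.div_const 2
  exact ((contDiffAt_flatScale hF hq).comp q h1).smul contDiffAt_id

theorem contDiffAt_toFlat (hF : IsBurnsSimancaPotential n F) {T : ℝ → ℝ}
    (hT : IsMomentProfileOf n F T) {z : Cn n} (hz : z ≠ 0) : ContDiffAt ℝ ∞ (toFlat F T) z := by
  have hs : 0 < ‖z‖ ^ 2 := by positivity
  have h1 : ContDiffAt ℝ ∞ (fun q : Cn n => T (‖q‖ ^ 2)) z :=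
    (hT.smooth _ hs.le).comp z (contDiff_norm_sq ℝ).contDiffAt
  have h2 := (contDiffAt_flatScale hF (hT.one_lt _ hs)).comp z h1
  exact (h2.inv (flatScale_pos F _).ne').smul contDiffAt_id

theorem ofFlat_toFlat {T : ℝ → ℝ} (hT : IsMomentProfileOf n F T) {z : Cn n} (hz : z ≠ 0) :
    ofFlat F (toFlat F T z) = z := by
  rw [ofFlat, norm_sq_toFlat hT hz, toFlat, smul_smul,
    mul_inv_cancel₀ (flatScale_pos F _).ne', one_smul]

theorem toFlat_ofFlat {T : ℝ → ℝ} (hT : IsMomentProfileOf n F T) {q : Cn n}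
    (hq : 1 < ‖q‖ ^ 2 / 2) : toFlat F T (ofFlat F q) = q := by
  rw [toFlat, norm_sq_ofFlat, hT.apply_mul_exp _ hq, ofFlat, smul_smul,
    inv_mul_cancel₀ (flatScale_pos F _).ne', one_smul]

theorem ofFlat_ne_zero {q : Cn n} (hq : 1 < ‖q‖ ^ 2 / 2) : ofFlat F q ≠ 0 :=
  smul_ne_zero (flatScale_pos F _).ne' fun h => by simp [h] at hq; linarith

/-- The change from the coordinate `z ≠ 0` to the flat coordinates, whose range is the region
`u > 1`. -/
noncomputable def flatHomeo (hF : IsBurnsSimancaPotential n F) {T : ℝ → ℝ}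
    (hT : IsMomentProfileOf n F T) : OpenPartialHomeomorph (Cn n) (Cn n) where
  toFun := toFlat F T
  invFun := ofFlat F
  source := {z | z ≠ 0}
  target := {q | 1 < ‖q‖ ^ 2 / 2}
  map_source' z hz := by
    change 1 < ‖toFlat F T z‖ ^ 2 / 2
    rw [norm_sq_toFlat hT hz]
    have : z ≠ 0 := hz
    exact hT.one_lt _ (by positivity)
  map_target' q hq := ofFlat_ne_zero hq
  left_inv' z hz := ofFlat_toFlat hT hz
  right_inv' q hq := toFlat_ofFlat hT hq
  open_source := isOpen_ne
  open_target := isOpen_lt continuous_const (by fun_prop)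
  continuousOn_toFun z hz := (contDiffAt_toFlat hF hT hz).continuousAt.continuousWithinAt
  continuousOn_invFun q hq := (contDiffAt_ofFlat hF hq).continuousAt.continuousWithinAt

/-- On the torus orbit the coordinates `toFlat` are the flat coordinates `√(2 x_i) exp (√-1 y_i)`. -/
theorem toFlat_toricVector (hF : IsBurnsSimancaPotential n F) {T : ℝ → ℝ}
    (hT : IsMomentProfileOf n F T) {x : Fin n → ℝ} (hx : x ∈ polytopeInterior n)
    (y : Fin n → ℝ) : toFlat F T (toricVector F (x, y)) = flatCoordinates (x, y) := by
  rw [toFlat, norm_sq_toricVector hF hx, hT.apply_mul_exp _ (one_lt_sum hx)]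
  ext i
  rw [PiLp.smul_apply, toricVector_apply, flatCoordinates]
  dsimp only
  have hx0 := hx.1 i
  rw [Complex.exp_add, ← Complex.ofReal_exp, legendre_eq hF hx]
  have h1 : Real.exp ((Real.log (x i) + 1 + deriv F (∑ i, x i)) / 2) =
      flatScale F (∑ i, x i) * √(2 * x i) := by
    rw [show (Real.log (x i) + 1 + deriv F (∑ i, x i)) / 2 =
      Real.log (x i) / 2 + (1 + deriv F (∑ i, x i)) / 2 by ring, Real.exp_add,
      ← Real.log_sqrt hx0.le, Real.exp_log (Real.sqrt_pos.2 hx0), flatScale,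
      Real.sqrt_mul (by norm_num)]
    field_simp
  rw [h1, mul_comm Complex.I, Complex.exp_mul_I, Complex.real_smul]
  have h2 : ((flatScale F (∑ i, x i))⁻¹ : ℂ) * (flatScale F (∑ i, x i) : ℂ) = 1 := by
    have := (flatScale_pos F (∑ i, x i)).ne'
    exact inv_mul_cancel₀ (by exact_mod_cast this)
  push_cast
  rw [← mul_assoc, ← mul_assoc, h2, one_mul]
  apply Complex.ext <;> simp [← Complex.ofReal_cos, ← Complex.ofReal_sin]

theorem exists_hasFDerivAt_ofFlat (hF : IsBurnsSimancaPotential n F) {q : Cn n}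
    (hq : 1 < ‖q‖ ^ 2 / 2) :
    ∃ L : Cn n →L[ℝ] Cn n, HasFDerivAt (ofFlat F) L q ∧ ∀ v,
      L v = flatScale F (‖q‖ ^ 2 / 2) •
        (v + (potentialDerivTwo n (‖q‖ ^ 2 / 2) / 2 * (inner ℂ q v).re) • q) := by
  have h1 : HasFDerivAt (fun q : Cn n => ‖q‖ ^ 2 / 2) (innerSL ℝ q) q := by
    have h := ((hasStrictFDerivAt_norm_sq q).hasFDerivAt).mul_const (1 / 2 : ℝ)
    refine (h.congr_fderiv ?_).congr_of_eventuallyEq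
      (Filter.Eventually.of_forall fun y => by simp; ring)
    ext v
    simp
  have h2 := ((hasDerivAt_flatScale hF hq).comp_hasFDerivAt q h1).smul (hasFDerivAt_id q)
  refine ⟨_, h2, fun v => ?_⟩
  rw [← real_inner_eq_re]
  simp [smul_smul, mul_assoc]

/-- The metric in flat coordinates: the Euclidean metric plus
`½ F'' dt² - 2 F'' / (1 + t F'') (∑ x_i dy_i)²`. -/
theorem profileForm_ofFlat {T : ℝ → ℝ}
    (hT : IsMomentProfileOf n F T) {q : Cn n} (hq : 1 < ‖q‖ ^ 2 / 2) {L : Cn n →L[ℝ] Cn n}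
    (hL : ∀ v, L v = flatScale F (‖q‖ ^ 2 / 2) •
        (v + (potentialDerivTwo n (‖q‖ ^ 2 / 2) / 2 * (inner ℂ q v).re) • q)) (v w : Cn n) :
    profileForm T (ofFlat F q) (L v) (L w) = inner ℝ v w +
      potentialDerivTwo n (‖q‖ ^ 2 / 2) / 2 * ((inner ℂ q v).re * (inner ℂ q w).re) -
      potentialDerivTwo n (‖q‖ ^ 2 / 2) /
        (1 + ‖q‖ ^ 2 / 2 * potentialDerivTwo n (‖q‖ ^ 2 / 2)) / 2 *
        ((inner ℂ q v).im * (inner ℂ q w).im) := by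
  have hft : 1 + ‖q‖ ^ 2 / 2 * potentialDerivTwo n (‖q‖ ^ 2 / 2) ≠ 0 := by
    rw [one_add_mul_potentialDerivTwo hq]
    exact (div_pos (pow_pos (by linarith) n) (denom_pos (n := n) hq)).ne'
  have hψ := flatScale_sq F (‖q‖ ^ 2 / 2)
  have hψ0 := (flatScale_pos F (‖q‖ ^ 2 / 2)).ne'
  have he := (Real.exp_pos (1 + deriv F (‖q‖ ^ 2 / 2))).ne'
  have hqq : inner ℝ q q = ‖q‖ ^ 2 := real_inner_self_eq_norm_sq q
  have hqqC : inner ℂ q q = ((‖q‖ ^ 2 : ℝ) : ℂ) := by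
    rw [inner_self_eq_norm_sq_to_K]; push_cast; rfl
  have hofFlat : radialForm (ofFlat F q) = flatScale F (‖q‖ ^ 2 / 2) ^ 2 • radialForm q := by
    have h := radialForm_smul (flatScale F (‖q‖ ^ 2 / 2) : ℂ) q
    rwa [Complex.norm_real, Real.norm_eq_abs, sq_abs] at h
  rw [profileForm, hofFlat, norm_sq_ofFlat, hT.apply_mul_exp _ hq, hT.deriv_mul_exp _ hq, hL, hL]
  simp only [add_apply, smul_apply, map_smul, map_add, smul_eq_mul, euclideanMetric_apply,
    radialForm_apply, hqqC, hqq]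
  simp only [Complex.inner, real_inner_eq_re q, real_inner_comm q v]
  have hq2 : ‖q‖ ^ 2 = 2 * (‖q‖ ^ 2 / 2) := by ring
  have ht : ‖q‖ ^ 2 / 2 ≠ 0 := by linarith
  generalize ‖q‖ ^ 2 / 2 = t at *
  generalize ‖q‖ ^ 2 = N at *
  generalize inner ℂ q v = a
  generalize inner ℂ q w = b
  generalize inner ℝ v w = E
  generalize potentialDerivTwo n t = f at *
  generalize Real.exp (1 + deriv F t) = e at *
  generalize flatScale F t = ψ at *
  subst hq2
  simp only [Complex.mul_re, Complex.conj_re, Complex.conj_im, Complex.ofReal_re,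
    Complex.ofReal_im]
  -- the square root hidden in `ψ` enters only through `ψ² = e / 2`
  obtain rfl : e = 2 * ψ ^ 2 := by linarith
  field_simp
  ring

/-- The two error terms are bounded by the Cauchy–Schwarz inequality. -/
theorem abs_flat_error_le {f t : ℝ} (hf : 0 ≤ f) (ht : 0 ≤ t) (q v w : Cn n) :
    |f / 2 * ((inner ℂ q v).re * (inner ℂ q w).re) -
      f / (1 + t * f) / 2 * ((inner ℂ q v).im * (inner ℂ q w).im)| ≤
      f * ‖q‖ ^ 2 * ‖v‖ * ‖w‖ := by
  have hre : ∀ u : Cn n, |(inner ℂ q u).re| ≤ ‖q‖ * ‖u‖ := fun u =>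
    (Complex.abs_re_le_norm _).trans (norm_inner_le_norm _ _)
  have him : ∀ u : Cn n, |(inner ℂ q u).im| ≤ ‖q‖ * ‖u‖ := fun u =>
    (Complex.abs_im_le_norm _).trans (norm_inner_le_norm _ _)
  have hft : 0 ≤ t * f := by positivity
  have h1 : f / (1 + t * f) ≤ f := div_le_self hf (by linarith)
  calc _ ≤ |f / 2 * ((inner ℂ q v).re * (inner ℂ q w).re)| +
        |f / (1 + t * f) / 2 * ((inner ℂ q v).im * (inner ℂ q w).im)| := abs_sub _ _
    _ = f / 2 * (|(inner ℂ q v).re| * |(inner ℂ q w).re|) +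
        f / (1 + t * f) / 2 * (|(inner ℂ q v).im| * |(inner ℂ q w).im|) := by
      rw [abs_mul, abs_mul, abs_mul, abs_mul, abs_of_nonneg (by positivity : 0 ≤ f / 2),
        abs_of_nonneg (by positivity : 0 ≤ f / (1 + t * f) / 2)]
    _ ≤ f / 2 * ((‖q‖ * ‖v‖) * (‖q‖ * ‖w‖)) + f / 2 * ((‖q‖ * ‖v‖) * (‖q‖ * ‖w‖)) := by
      gcongr
      exacts [hre v, hre w, him v, him w]
    _ = _ := by ring

theorem isFlatUpTo_of_isMetricOfPotential [NeZero n] (hn : 2 ≤ n)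
    (hF : IsBurnsSimancaPotential n F) {h : SmoothMetric n (BlowUp n)}
    (hh : IsMetricOfPotential F h) : IsFlatUpTo F h (1 - (n : ℤ)) := by
  obtain ⟨T, hT⟩ := hF.exists_isMomentProfileOf hn
  obtain ⟨c, t₀, ht₀, hc⟩ := hF.exists_deriv_limit hn
  have hn' : (2 : ℝ) ≤ n := by exact_mod_cast hn
  set φ : OpenPartialHomeomorph (BlowUp n) (Cn n) :=
    (BlowUp.blowDownHomeo n).trans' (flatHomeo hF hT) rfl
  have hsymm : ∀ q, φ.symm q = BlowUp.blowUpPoint (ofFlat F q) := fun q => rfl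
  have hsource : φ.source = {p | p.blowDown ≠ 0} := rfl
  have htarget : φ.target = {q | 1 < ‖q‖ ^ 2 / 2} := rfl
  refine ⟨φ, hsource, htarget, ?_, ?_, ?_, ?_⟩
  · intro p hp
    exact ((contDiffAt_toFlat hF hT hp).contMDiffAt.comp p
      BlowUp.contMDiff_blowDown_real.contMDiffAt).contMDiffWithinAt
  · intro q hq
    exact ((BlowUp.contMDiffAt_blowUpPoint_real (ofFlat_ne_zero hq)).comp q
      (contDiffAt_ofFlat hF hq).contMDiffAt).contMDiffWithinAt
  · intro x hx y
    exact toFlat_toricVector hF hT hx y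
  · refine Asymptotics.IsBigO.of_bound (4 * (n - 1)) ?_
    filter_upwards [eventually_cobounded_le_norm (2 * t₀)] with q hq
    have htt₀ : t₀ ≤ ‖q‖ ^ 2 / 2 := by nlinarith
    have ht1 : 1 < ‖q‖ ^ 2 / 2 := ht₀.trans_le htt₀
    obtain ⟨hP, -, -⟩ := hc _ htt₀
    have hf0 := potentialDerivTwo_nonneg hn ht1
    have hf1 := mul_potentialDerivTwo_le hn ht1 hP
    obtain ⟨L, hL, hL'⟩ := exists_hasFDerivAt_ofFlat hF ht1
    have hz : (‖q‖ ^ 2 / 2) ^ (1 - (n : ℤ)) = ((‖q‖ ^ 2 / 2) ^ (n - 1))⁻¹ := by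
      rw [← zpow_natCast (‖q‖ ^ 2 / 2), ← zpow_neg]
      congr 1
      push_cast [Nat.cast_sub (by omega : 1 ≤ n)]
      ring
    rw [hz, Real.norm_of_nonneg (by positivity), ← div_eq_mul_inv]
    have hn1 : (0 : ℝ) ≤ n - 1 := by linarith
    refine ContinuousLinearMap.opNorm_le_bound₂ _ (by positivity) fun v w => ?_
    rw [sub_apply, sub_apply,
      metricInCoordinates_of_symm_eq h φ hsymm hL (ofFlat_ne_zero ht1),
      metricInCoordinates_eq_profileForm hF hT hh (ofFlat_ne_zero ht1),
      profileForm_ofFlat hT ht1 hL', euclideanMetric_apply, add_sub_assoc, add_sub_cancel_left,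
      Real.norm_eq_abs]
    refine (abs_flat_error_le hf0 (by linarith) q v w).trans ?_
    gcongr
    calc _ = 2 * (‖q‖ ^ 2 / 2 * potentialDerivTwo n (‖q‖ ^ 2 / 2)) := by ring
      _ ≤ 2 * (2 * (n - 1) / (‖q‖ ^ 2 / 2) ^ (n - 1)) := by gcongr
      _ = _ := by ring

end Flat

theorem mainTheorem3 (n : ℕ) [NeZero n] (hn : 2 ≤ n) :
    (∃ F : ℝ → ℝ, IsBurnsSimancaPotential n F) ∧
    ∀ F : ℝ → ℝ, IsBurnsSimancaPotential n F →
      (∃ h : SmoothMetric n (BlowUp n), IsMetricOfPotential F h) ∧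
      ∀ h : SmoothMetric n (BlowUp n), IsMetricOfPotential F h →
        IsAsymptoticallyEuclidean h (2 - 2 * (n : ℤ)) ∧ IsFlatUpTo F h (1 - (n : ℤ)) := by
  refine ⟨exists_potential hn, fun F hF => ?_⟩
  obtain ⟨T, hT⟩ := hF.exists_isMomentProfileOf hn
  exact ⟨⟨BlowUp.invariantMetric hT.toIsMomentProfile, isMetricOfPotential_invariantMetric hF hT⟩,
    fun h hh => ⟨isAsymptoticallyEuclidean_of_isMetricOfPotential hn hF hh,
      isFlatUpTo_of_isMetricOfPotential hn hF hh⟩⟩
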